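/- **Proposition 1 (Optimal Hamiltonian System).** Let $t_0<t_f$, let $\mathcal X\subseteq\mathbb R^{d_x}$ be open, let $\mathcal U\subseteq\mathbb R^{d_u}$ be any set (bounded or not), and let $x_0\in\mathcal X$. Let $f:\mathcal X\to\mathbb R^{d_x}$, $g:\mathcal X\to\mathbb R^{d_x\times d_u}$ and $q:\mathcal X\to\mathbb R$ be continuously differentiable, $\Phi:\mathcal X\to\mathbb R$ differentiable, and $c:\mathcal U\to\mathbb R$ continuous. An admissible control is an integrable function $u:[t_0,t_f]\to\mathcal U$ for which $c\circ u$ is integrable; a trajectory of $u$ is an absolutely continuous $x:[t_0,t_f]\to\mathcal X$ with $x(t_0)=x_0$ and $\dot x(t)=f(x(t))+g(x(t))u(t)$ for almost every $t$. Let $u^\star$ be an admissible control with trajectory $x^\star$ that minimizes $$J(u)=\Phi(x(t_f))+\int_{t_0}^{t_f}\bigl(q(x(t))+c(u(t))\bigr)\,dt$$ among all admissible controls $u$ that have a trajectory $x$ on $[t_0,t_f]$. Put $\mathcal H(x,\lambda,u)=q(x)+c(u)+\lambda^\top\bigl(f(x)+g(x)u\bigr)$. Then there is an absolutely continuous co-state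 $\lambda^\star:[t_0,t_f]\to\mathbb R^{d_x}$ such that $$x^\star(t_0)=x_0,\qquad \lambda^\star(t_f)=\nabla\Phi(x^\star(t_f)),$$ and, for almost every $t\in[t_0,t_f]$, $$\dot x^\star=\nabla_\lambda\mathcal H(x^\star,\lambda^\star,u^\star)=f(x^\star)+g(x^\star)u^\star,$$ $$\dot\lambda^\star=-\nabla_x\mathcal H(x^\star,\lambda^\star,u^\star)=-\nabla q(x^\star)-\bigl(\nabla_x[f(x)+g(x)u^\star]_{x=x^\star}\bigr)\lambda^\star,$$ $$u^\star(t)\in\operatorname*{arg\,min}_{u\in\mathcal U}\mathcal H(x^\star(t),\lambda^\star(t),u),$$ where $(\nabla_xF)_{ij}=\partial F_j/\partial x_i$. Moreover these three relations hold at every single time $t\in[t_0,t_f]$ at which $u^\star$ is continuous, and, with the corresponding one-sided derivatives, at every $t$ at which $u^\star$ is continuous from the left or from the right; in particular they hold at all times if $u^\star$ is continuous. -/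

import Mathlib

open MeasureTheory Set

/-- `n`-dimensional Euclidean space. -/
abbrev Euc (n : ℕ) : Type := EuclideanSpace ℝ (Fin n)

/-- The data of a control-affine optimal control problem with free end point: minimize
`Φ (x t_f) + ∫ (q (x t) + c (u t)) dt` over `[t₀, t_f]` subject to `x' = f x + g x u`,
`x t₀ = x₀`, with states in `X ⊆ ℝⁿ` and control values in `U ⊆ ℝᵐ`. The matrix `g x` is
represented by the linear map `ℝᵐ → ℝⁿ` that it defines. -/
structure ControlProblem (n m : ℕ) where
  /-- drift -/
  f : Euc n → Euc n
  /-- control-influence matrix -/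
  g : Euc n → Euc m →L[ℝ] Euc n
  /-- state cost -/
  q : Euc n → ℝ
  /-- control cost -/
  c : Euc m → ℝ
  /-- terminal cost -/
  Φ : Euc n → ℝ
  /-- state space -/
  X : Set (Euc n)
  /-- set of control values -/
  U : Set (Euc m)
  /-- initial time -/
  t₀ : ℝ
  /-- final time -/
  tf : ℝ
  /-- initial state -/
  x₀ : Euc n

/-- `y` is a solution of `y' = F (t, y)` on `[a, b]` in the sense of Carathéodory: it is
absolutely continuous and satisfies the equation at almost every time. -/
def IsCaratheodorySolution {n : ℕ} (F : ℝ → Euc n → Euc n) (a b : ℝ) (y : ℝ → Euc n) : Prop :=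
  AbsolutelyContinuousOnInterval y a b ∧
    ∀ᵐ t ∂(volume.restrict (Icc a b)), HasDerivAt y (F t (y t)) t

namespace ControlProblem

variable {n m : ℕ} (P : ControlProblem n m)

/-- The right-hand side `f x + g x u` of the state equation. -/
noncomputable def dyn (x : Euc n) (u : Euc m) : Euc n := P.f x + P.g x u

/-- The control-Hamiltonian `q x + c u + lᵀ (f x + g x u)`. -/
noncomputable def hamiltonian (x l : Euc n) (u : Euc m) : ℝ :=
  P.q x + P.c u + inner ℝ l (P.dyn x u)

/-- Admissible controls: integrable (in particular measurable) functions on `[t₀, t_f]` with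
values in `U`, whose control cost is integrable. -/
def IsControl (u : ℝ → Euc m) : Prop :=
  (∀ t ∈ Icc P.t₀ P.tf, u t ∈ P.U) ∧
    IntervalIntegrable u volume P.t₀ P.tf ∧
    IntervalIntegrable (fun t => P.c (u t)) volume P.t₀ P.tf

/-- `x` is a trajectory of the control `u`, defined on all of `[t₀, t_f]`. -/
def IsTrajectory (u : ℝ → Euc m) (x : ℝ → Euc n) : Prop :=
  (∀ t ∈ Icc P.t₀ P.tf, x t ∈ P.X) ∧ x P.t₀ = P.x₀ ∧
    IsCaratheodorySolution (fun t z => P.dyn z (u t)) P.t₀ P.tf x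

/-- The cost of a control `u` with trajectory `x`. -/
noncomputable def cost (u : ℝ → Euc m) (x : ℝ → Euc n) : ℝ :=
  P.Φ (x P.tf) + ∫ t in P.t₀..P.tf, (P.q (x t) + P.c (u t))

/-- `u` is an optimal control with optimal trajectory `x`. -/
def IsOptimal (u : ℝ → Euc m) (x : ℝ → Euc n) : Prop :=
  P.IsControl u ∧ P.IsTrajectory u x ∧
    ∀ v y, P.IsControl v → P.IsTrajectory v y → P.cost u x ≤ P.cost v y

/-- `u` is a minimizer over `U` of the Hamiltonian at `(x, l)`. -/
def MinimizesHamiltonian (x l : Euc n) (u : Euc m) : Prop :=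
  u ∈ P.U ∧ ∀ v ∈ P.U, P.hamiltonian x l u ≤ P.hamiltonian x l v

end ControlProblem

/-!
The proof is the direct one by needle variations, with the co-state used as a test function, so that
no linearized state equation has to be solved.

Let `l` solve the linear co-state equation backwards from `l t_f = ∇Φ (x t_f)`
(`ControlProblem.exists_costate`). If a control `w` is close to `u` in `L¹`, it has a trajectory `y`
on all of `[t₀, t_f]` with `‖y - x‖ ≤ C ‖w - u‖₁` (`IsTrajectory.exists_nearby_trajectory`).
Integrating the derivative of `⟨l, y - x⟩` by parts turns the change of the terminal cost into an
integral in which the co-state equation cancels all terms linear in `y - x`. What is left is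
`J w - J u ≤ ∫ (H (x, l, w) - H (x, l, u)) + o(‖w - u‖₁)`, and optimality of `u` gives
`0 ≤ ∫ (H (x, l, w) - H (x, l, u)) + η ‖w - u‖₁` for every `η > 0` and all `w` near `u`
(`IsOptimal.exists_le_integral_hamiltonian_sub`).

Taking for `w` the control that equals `v ∈ U` on `(τ, s]` and `u` elsewhere, dividing by `s - τ`
and letting `s → τ`, Lebesgue's differentiation theorem yields
`0 ≤ H (x, l, v) - H (x, l, u) + η ‖v - u‖` at almost every `τ`, for each fixed `v`
(`IsOptimal.ae_hamiltonian_le`). A countable dense set of values `v` and the continuity of `c` give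
the minimum condition almost everywhere, and it passes by continuity to every time at which `u` is
continuous from one side.

Existence of the trajectories and of the co-state is Carathéodory's theorem for right-hand sides
with an integrable Lipschitz constant `k`. It is proved by the contraction principle for the supremum
norm weighted by `exp (-2 ∫ k)`, in which the integral operator has Lipschitz constant `1 / 2`
(`exists_integral_equation_solution`); the a priori bound of the fixed point is the estimate for
`y - x`.
-/

open Filter Topology

/-! ### Absolutely continuous functions -/

section AbsolutelyContinuous

variable {E : Type*} [NormedAddCommGroup E]

/-- A function whose increments are dominated by those of two absolutely continuous functions is
absolutely continuous. -/
theorem AbsolutelyContinuousOnInterval.of_dist_le {X Y Z : Type*} [PseudoMetricSpace X]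
    [PseudoMetricSpace Y] [PseudoMetricSpace Z] {f : ℝ → X} {g : ℝ → Y} {h : ℝ → Z} {a b C D : ℝ}
    (hg : AbsolutelyContinuousOnInterval g a b) (hh : AbsolutelyContinuousOnInterval h a b)
    (H : ∀ s ∈ uIcc a b, ∀ t ∈ uIcc a b,
      dist (f s) (f t) ≤ C * dist (g s) (g t) + D * dist (h s) (h t)) :
    AbsolutelyContinuousOnInterval f a b := by
  unfold AbsolutelyContinuousOnInterval at hg hh ⊢
  refine squeeze_zero' (.of_forall fun _ ↦ Finset.sum_nonneg fun i _ ↦ dist_nonneg) ?_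
    (by simpa using (hg.const_mul C).add (hh.const_mul D))
  rw [eventually_inf_principal]
  filter_upwards with E hE
  simp only [Finset.mul_sum, ← Finset.sum_add_distrib]
  exact Finset.sum_le_sum fun i hi ↦ H _ (hE.1 i hi).1 _ (hE.1 i hi).2

theorem IntervalIntegrable.mono_uIcc {f : ℝ → E} {a b c d : ℝ}
    (h : IntervalIntegrable f volume a b) (hc : c ∈ uIcc a b) (hd : d ∈ uIcc a b) :
    IntervalIntegrable f volume c d :=
  h.mono_set (uIcc_subset_uIcc hc hd)

variable [NormedSpace ℝ E]

theorem IntervalIntegrable.absolutelyContinuousOnInterval_integral {f : ℝ → E} {a b c : ℝ}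
    (h : IntervalIntegrable f volume a b) (hc : c ∈ uIcc a b) :
    AbsolutelyContinuousOnInterval (fun t ↦ ∫ s in c..t, f s) a b := by
  have hn := h.norm.absolutelyContinuousOnInterval_intervalIntegral hc
  refine hn.of_dist_le (C := 1) (D := 0) hn fun s hs t ht ↦ ?_
  rw [dist_eq_norm, dist_eq_norm, intervalIntegral.integral_interval_sub_left
    (h.mono_uIcc hc hs) (h.mono_uIcc hc ht), intervalIntegral.integral_interval_sub_left
    (h.norm.mono_uIcc hc hs) (h.norm.mono_uIcc hc ht)]
  simpa using intervalIntegral.norm_integral_le_abs_integral_norm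

variable [CompleteSpace E]

/-- The fundamental theorem of calculus for an absolutely continuous function whose derivative is
known almost everywhere: the difference of the function and the integral of the derivative is
absolutely continuous with zero derivative. -/
theorem AbsolutelyContinuousOnInterval.integral_eq_sub {f f' : ℝ → E} {a b : ℝ}
    (hf : AbsolutelyContinuousOnInterval f a b) (hf' : IntervalIntegrable f' volume a b)
    (hd : ∀ᵐ t, t ∈ uIcc a b → HasDerivAt f (f' t) t) {c d : ℝ} (hc : c ∈ uIcc a b)
    (hdd : d ∈ uIcc a b) :
    ∫ t in c..d, f' t = f d - f c := by
  have hg := hf.sub (hf'.absolutelyContinuousOnInterval_integral hc)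
  obtain ⟨C, hC⟩ := hg.const_of_ae_hasDerivAt_zero (by
    filter_upwards [hd, hf'.ae_hasDerivAt_integral] with t h1 h2 ht
    simpa using (h1 ht).sub (h2 ht c hc))
  have h1 := hC c hc
  have h2 := hC d hdd
  simp only [Pi.sub_apply, intervalIntegral.integral_same, sub_zero] at h1 h2
  rw [h1, ← h2]; abel

/-- Functions given by an integral equation are absolutely continuous and satisfy the corresponding
differential equation almost everywhere. -/
theorem absolutelyContinuousOnInterval_of_integral_eq {y F : ℝ → E} {a b c : ℝ} {y₀ : E}
    (hab : a ≤ b) (hc : c ∈ Icc a b) (hF : IntervalIntegrable F volume a b)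
    (hy : ∀ t ∈ Icc a b, y t = y₀ + ∫ s in c..t, F s) :
    AbsolutelyContinuousOnInterval y a b ∧
      ∀ᵐ t ∂(volume.restrict (Icc a b)), HasDerivAt y (F t) t := by
  rw [← uIcc_of_le hab] at hc
  constructor
  · have h := hF.absolutelyContinuousOnInterval_integral hc
    refine h.of_dist_le (C := 1) (D := 0) h fun s hs t ht ↦ ?_
    rw [uIcc_of_le hab] at hs ht
    simp [hy s hs, hy t ht]
  · rw [ae_restrict_iff' measurableSet_Icc]
    have h₁ : ∀ᵐ t : ℝ, t ≠ a := by simp [ae_iff, measure_singleton]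
    have h₂ : ∀ᵐ t : ℝ, t ≠ b := by simp [ae_iff, measure_singleton]
    filter_upwards [hF.ae_hasDerivAt_integral, h₁, h₂] with t h h1 h2 ht
    refine ((h (by rwa [uIcc_of_le hab]) c hc).const_add y₀).congr_of_eventuallyEq ?_
    filter_upwards [Icc_mem_nhds (lt_of_le_of_ne ht.1 h1.symm) (lt_of_le_of_ne ht.2 h2)] with s hs
      using hy s hs

end AbsolutelyContinuous

/-! ### Carathéodory's existence theorem -/

section Caratheodory

variable {E : Type*} [NormedAddCommGroup E] [NormedSpace ℝ E] [CompleteSpace E]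

/-- The weight `exp (2 ∫ k)` is a primitive of `2 k exp (2 ∫ k)`. -/
theorem integral_mul_exp_two_mul_integral {k : ℝ → ℝ} {a b : ℝ}
    (hk : IntervalIntegrable k volume a b) {t : ℝ} (ht : t ∈ uIcc a b) :
    ∫ s in a..t, k s * Real.exp (2 * ∫ r in a..s, k r) =
      (Real.exp (2 * ∫ r in a..t, k r) - 1) / 2 := by
  have hK := hk.absolutelyContinuousOnInterval_integral (left_mem_uIcc (a := a) (b := b))
  obtain ⟨C, hC⟩ := hK.exists_bound
  obtain ⟨L, hL⟩ := (Real.contDiff_exp (n := 1)).contDiffOn.exists_lipschitzOnWith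
    (s := Icc (-(2 * C)) (2 * C)) (by decide) (convex_Icc _ _) isCompact_Icc
  have hmem : ∀ s ∈ uIcc a b, 2 * ∫ r in a..s, k r ∈ Icc (-(2 * C)) (2 * C) := by
    intro s hs
    have := abs_le.1 (hC s hs)
    constructor <;> linarith
  -- `exp` is Lipschitz on the bounded range of the primitive
  have hexp : AbsolutelyContinuousOnInterval (fun s ↦ Real.exp (2 * ∫ r in a..s, k r)) a b := by
    refine hK.of_dist_le (C := L * 2) (D := 0) hK fun s hs t ht ↦ ?_
    refine (hL.dist_le_mul _ (hmem s hs) _ (hmem t ht)).trans ?_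
    rw [Real.dist_eq, Real.dist_eq, ← mul_sub, abs_mul, abs_two]
    exact le_of_eq (by ring)
  have := hexp.integral_eq_sub (f' := fun s ↦ 2 * (k s * Real.exp (2 * ∫ r in a..s, k r)))
    ((hk.mul_continuousOn hexp.continuousOn).const_mul 2) (by
      filter_upwards [hk.ae_hasDerivAt_integral] with s hs hs'
      exact ((hs hs' a left_mem_uIcc).const_mul 2).exp.congr_deriv (by ring)) left_mem_uIcc ht
  rw [intervalIntegral.integral_const_mul] at this
  simp only [intervalIntegral.integral_same, mul_zero, Real.exp_zero] at this
  linarith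

/-- Global existence for an integral equation whose right-hand side is Lipschitz in the state
with an integrable constant, with a bound on the distance to the initial value. -/
theorem exists_integral_equation_solution {G : ℝ → E → E} {k : ℝ → ℝ} {a b : ℝ} (hab : a ≤ b)
    (y₀ : E) (hk : IntervalIntegrable k volume a b) (hk0 : ∀ t ∈ Icc a b, 0 ≤ k t)
    (hG : ∀ t ∈ Icc a b, ∀ z w, ‖G t z - G t w‖ ≤ k t * ‖z - w‖)
    (hint : ∀ z : ℝ → E, ContinuousOn z (Icc a b) →
      IntervalIntegrable (fun t ↦ G t (z t)) volume a b) :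
    ∃ y : ℝ → E, ContinuousOn y (Icc a b) ∧
      (∀ t ∈ Icc a b, y t = y₀ + ∫ s in a..t, G s (y s)) ∧
      ∀ t ∈ Icc a b, ‖y t - y₀‖ ≤
        2 * Real.exp (2 * ∫ s in a..b, k s) * ∫ s in a..b, ‖G s y₀‖ := by
  have hu : uIcc a b = Icc a b := uIcc_of_le hab
  set K : ℝ → ℝ := fun t ↦ ∫ s in a..t, k s
  have hKc : ContinuousOn K (Icc a b) := by
    have := (hk.absolutelyContinuousOnInterval_integral
      (left_mem_uIcc (a := a) (b := b))).continuousOn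
    rwa [hu] at this
  have hK0 : ∀ t ∈ Icc a b, 0 ≤ K t := fun t ht ↦
    intervalIntegral.integral_nonneg ht.1 fun s hs ↦ hk0 s ⟨hs.1, hs.2.trans ht.2⟩
  have hKb : ∀ t ∈ Icc a b, K t ≤ K b := fun t ht ↦ by
    have : K b - K t = ∫ s in t..b, k s := intervalIntegral.integral_interval_sub_left hk
      (hk.mono_uIcc left_mem_uIcc (hu ▸ ht))
    have h2 : 0 ≤ ∫ s in t..b, k s :=
      intervalIntegral.integral_nonneg ht.2 fun s hs ↦ hk0 s ⟨ht.1.trans hs.1, hs.2⟩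
    linarith
  -- The state is `y₀ + exp (2 K) z` with `z` in the space of continuous functions: the supremum
  -- norm of `z` is then the weighted norm of the deviation of the state from `y₀`.
  let S : C(Icc a b, E) → ℝ → E := fun z t ↦ y₀ + Real.exp (2 * K t) • IccExtend hab z t
  have hSc : ∀ z, ContinuousOn (S z) (Icc a b) := fun z ↦
    continuousOn_const.add ((Real.continuous_exp.comp_continuousOn
      (continuousOn_const.mul hKc)).smul z.continuous.Icc_extend'.continuousOn)
  have hI := fun z ↦ hint (S z) (hSc z)
  have hTc : ∀ z, ContinuousOn (fun t ↦ Real.exp (-(2 * K t)) • ∫ s in a..t, G s (S z s))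
      (Icc a b) := fun z ↦ by
    have := ((hI z).absolutelyContinuousOnInterval_integral
      (left_mem_uIcc (a := a) (b := b))).continuousOn
    rw [hu] at this
    exact (Real.continuous_exp.comp_continuousOn (continuousOn_const.mul hKc).neg).smul this
  let T : C(Icc a b, E) → C(Icc a b, E) := fun z ↦
    ⟨fun t ↦ Real.exp (-(2 * K t)) • ∫ s in a..(t : ℝ), G s (S z s),
      continuousOn_iff_continuous_domRestrict.1 (hTc z)⟩
  have hT : ContractingWith (1 / 2) T := by
    refine ⟨by norm_num [← NNReal.coe_lt_coe], LipschitzWith.of_dist_le_mul fun z w ↦ ?_⟩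
    rw [ContinuousMap.dist_le (by positivity)]
    rintro ⟨t, ht⟩
    have ht' : t ∈ uIcc a b := hu ▸ ht
    have hsub : IntervalIntegrable (fun s ↦ G s (S z s) - G s (S w s)) volume a t :=
      ((hI z).mono_uIcc left_mem_uIcc ht').sub ((hI w).mono_uIcc left_mem_uIcc ht')
    have hexp : IntervalIntegrable (fun s ↦ k s * Real.exp (2 * K s)) volume a t :=
      (hk.mul_continuousOn (Real.continuous_exp.comp_continuousOn
        (continuousOn_const.mul (hu ▸ hKc)))).mono_uIcc left_mem_uIcc ht'
    have hpt : ∀ s ∈ Icc a t, ‖G s (S z s) - G s (S w s)‖ ≤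
        k s * Real.exp (2 * K s) * dist z w := fun s hs ↦ by
      have hs' : s ∈ Icc a b := ⟨hs.1, hs.2.trans ht.2⟩
      refine (hG s hs' _ _).trans ?_
      rw [mul_assoc]
      refine mul_le_mul_of_nonneg_left ?_ (hk0 s hs')
      have : S z s - S w s = Real.exp (2 * K s) • (z ⟨s, hs'⟩ - w ⟨s, hs'⟩) := by
        simp [S, IccExtend_of_mem hab _ hs', smul_sub]
      rw [this, norm_smul, Real.norm_of_nonneg (Real.exp_pos _).le, ← dist_eq_norm]
      exact mul_le_mul_of_nonneg_left (ContinuousMap.dist_apply_le_dist _) (Real.exp_pos _).le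
    calc dist (T z ⟨t, ht⟩) (T w ⟨t, ht⟩)
        = Real.exp (-(2 * K t)) * ‖∫ s in a..t, (G s (S z s) - G s (S w s))‖ := by
          rw [intervalIntegral.integral_sub ((hI z).mono_uIcc left_mem_uIcc ht')
            ((hI w).mono_uIcc left_mem_uIcc ht')]
          rw [dist_eq_norm]
          change ‖Real.exp (-(2 * K t)) • (∫ s in a..t, G s (S z s)) -
            Real.exp (-(2 * K t)) • (∫ s in a..t, G s (S w s))‖ = _
          rw [← smul_sub, norm_smul, Real.norm_of_nonneg (Real.exp_pos _).le]
      _ ≤ Real.exp (-(2 * K t)) * ∫ s in a..t, k s * Real.exp (2 * K s) * dist z w := by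
          gcongr
          refine (intervalIntegral.norm_integral_le_integral_norm ht.1).trans ?_
          exact intervalIntegral.integral_mono_on ht.1 hsub.norm (hexp.mul_const _) hpt
      _ = (1 - Real.exp (-(2 * K t))) / 2 * dist z w := by
          rw [intervalIntegral.integral_mul_const, integral_mul_exp_two_mul_integral hk ht']
          have : Real.exp (-(2 * K t)) * Real.exp (2 * K t) = 1 := by
            rw [← Real.exp_add]; simp
          linear_combination (dist z w / 2) * this
      _ ≤ ((1 / 2 : NNReal) : ℝ) * dist z w := by
          have := Real.exp_pos (-(2 * K t))
          gcongr
          push_cast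
          linarith
  have : Nonempty C(Icc a b, E) := ⟨0⟩
  set z := hT.fixedPoint T with hz
  have hfix : T z = z := hT.fixedPoint_isFixedPt
  have hSz : ∀ t ∈ Icc a b, S z t = y₀ + ∫ s in a..t, G s (S z s) := fun t ht ↦ by
    have h1 : Real.exp (-(2 * K t)) • ∫ s in a..t, G s (S z s) = z ⟨t, ht⟩ :=
      congrArg (fun f : C(Icc a b, E) ↦ f ⟨t, ht⟩) hfix
    conv_lhs => simp only [S]
    rw [IccExtend_of_mem hab _ ht, ← h1, smul_smul, ← Real.exp_add]
    simp
  refine ⟨S z, hSc z, hSz, fun t ht ↦ ?_⟩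
  have hS0 : S 0 = fun _ ↦ y₀ := by
    ext t
    simp [S, IccExtend]
  have hN := hint (fun _ ↦ y₀) continuousOn_const
  have hdist : ‖z‖ ≤ 2 * ∫ s in a..b, ‖G s y₀‖ := by
    have h1 := hT.dist_fixedPoint_le 0
    have h2 : dist 0 (T 0) ≤ ∫ s in a..b, ‖G s y₀‖ := by
      have hnn : 0 ≤ ∫ s in a..b, ‖G s y₀‖ :=
        intervalIntegral.integral_nonneg hab fun _ _ ↦ norm_nonneg _
      rw [ContinuousMap.dist_le hnn]
      rintro ⟨t, ht⟩
      have ht' : t ∈ uIcc a b := hu ▸ ht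
      simp only [T, hS0, ContinuousMap.coe_mk, ContinuousMap.zero_apply, dist_zero_left, norm_smul,
        Real.norm_of_nonneg (Real.exp_pos _).le]
      have h3 : ‖∫ s in a..t, G s y₀‖ ≤ ∫ s in a..b, ‖G s y₀‖ := by
        refine (intervalIntegral.norm_integral_le_integral_norm ht.1).trans ?_
        exact intervalIntegral.integral_mono_interval le_rfl ht.1 ht.2
          (.of_forall fun _ ↦ norm_nonneg _) hN.norm
      have h4 : Real.exp (-(2 * K t)) ≤ 1 := by
        rw [Real.exp_le_one_iff]; linarith [hK0 t ht]
      calc _ ≤ 1 * _ := mul_le_mul h4 h3 (norm_nonneg _) zero_le_one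
        _ = _ := one_mul _
    rw [dist_zero_left, ← hz] at h1
    refine h1.trans ?_
    have h3 : (1 : ℝ) - ((1 / 2 : NNReal) : ℝ) = 1 / 2 := by norm_num
    rw [h3]
    linarith
  have : ‖S z t - y₀‖ ≤ Real.exp (2 * K b) * ‖z‖ := by
    simp only [S, add_sub_cancel_left, norm_smul, Real.norm_of_nonneg (Real.exp_pos _).le,
      IccExtend_of_mem hab _ ht]
    gcongr
    · exact hKb t ht
    · exact z.norm_coe_le_norm _
  calc _ ≤ _ := this
    _ ≤ Real.exp (2 * K b) * (2 * ∫ s in a..b, ‖G s y₀‖) := by gcongr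
    _ = _ := by ring

end Caratheodory

/-! ### Uniform differentiability near compact sets -/

section UniformDifferentiability

variable {E F : Type*} [NormedAddCommGroup E] [NormedSpace ℝ E] [NormedAddCommGroup F]
  [NormedSpace ℝ F]

theorem ContDiffOn.continuousOn_fderiv_of_isOpen_one {f : E → F} {X : Set E} (hX : IsOpen X)
    (hf : ContDiffOn ℝ 1 f X) : ContinuousOn (fderiv ℝ f) X :=
  hf.continuousOn_fderiv_of_isOpen hX le_rfl

theorem ContDiffOn.differentiableAt_of_isOpen {f : E → F} {X : Set E} (hX : IsOpen X)
    (hf : ContDiffOn ℝ 1 f X) {x : E} (hx : x ∈ X) : DifferentiableAt ℝ f x :=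
  (hf.differentiableOn one_ne_zero).differentiableAt (hX.mem_nhds hx)

/-- A continuously differentiable function is strictly differentiable uniformly at the points of a
compact set: on a small ball about such a point the derivative is close to its value at the centre,
and the mean value inequality applies. -/
theorem ContDiffOn.exists_uniform_fderiv_approx {f : E → F} {X K : Set E} (hX : IsOpen X)
    (hf : ContDiffOn ℝ 1 f X) (hK : IsCompact K) (hKX : K ⊆ X) {η : ℝ} (hη : 0 < η) :
    ∃ ρ > 0, ∀ p ∈ K, Metric.closedBall p ρ ⊆ X ∧
      ∀ z ∈ Metric.closedBall p ρ, ∀ w ∈ Metric.closedBall p ρ,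
        ‖f z - f w - fderiv ℝ f p (z - w)‖ ≤ η * ‖z - w‖ := by
  obtain ⟨ρ₁, hρ₁, h₁⟩ := hK.exists_cthickening_subset_open hX hKX
  have h := hK.uniformContinuousAt_of_continuousAt (fderiv ℝ f)
    (fun a ha ↦ (hf.continuousOn_fderiv_of_isOpen_one hX).continuousAt (hX.mem_nhds (hKX ha)))
    (Metric.dist_mem_uniformity hη)
  obtain ⟨ρ₂, hρ₂, h₂⟩ := Metric.mem_uniformity_dist.1 h
  refine ⟨min ρ₁ (ρ₂ / 2), by positivity, fun p hp ↦ ?_⟩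
  have hsub : Metric.closedBall p (min ρ₁ (ρ₂ / 2)) ⊆ X := fun z hz ↦
    h₁ (Metric.closedBall_subset_cthickening hp _
      (Metric.closedBall_subset_closedBall (min_le_left _ _) hz))
  refine ⟨hsub, fun z hz w hw ↦ ?_⟩
  refine (convex_closedBall p _).norm_image_sub_le_of_norm_fderiv_le' (f := f)
    (fun y hy ↦ hf.differentiableAt_of_isOpen hX (hsub hy)) (fun y hy ↦ ?_) hw hz
  have hd : Dist.dist p y < ρ₂ := by
    rw [dist_comm]
    exact (Metric.mem_closedBall.1 hy).trans_lt ((min_le_right _ _).trans_lt (half_lt_self hρ₂))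
  have := @h₂ p y hd hp
  rw [← dist_eq_norm, dist_comm]
  exact (show Dist.dist (fderiv ℝ f p) (fderiv ℝ f y) < η from this).le

/-- A continuously differentiable function is Lipschitz, with a uniform constant, on the balls of
a fixed radius centred at the points of a compact set. -/
theorem ContDiffOn.exists_uniform_lipschitz {f : E → F} {X K : Set E} (hX : IsOpen X)
    (hf : ContDiffOn ℝ 1 f X) (hK : IsCompact K) (hKX : K ⊆ X) :
    ∃ L ≥ 0, ∃ ρ > 0, ∀ p ∈ K, Metric.closedBall p ρ ⊆ X ∧
      ∀ z ∈ Metric.closedBall p ρ, ∀ w ∈ Metric.closedBall p ρ,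
        ‖f z - f w‖ ≤ L * ‖z - w‖ := by
  obtain ⟨ρ, hρ, h⟩ := hf.exists_uniform_fderiv_approx hX hK hKX one_pos
  obtain ⟨M, hM⟩ := hK.exists_bound_of_continuousOn
    ((hf.continuousOn_fderiv_of_isOpen_one hX).mono hKX)
  refine ⟨1 + max M 0, by positivity, ρ, hρ, fun p hp ↦ ⟨(h p hp).1, fun z hz w hw ↦ ?_⟩⟩
  have h1 := (h p hp).2 z hz w hw
  have h2 : ‖fderiv ℝ f p (z - w)‖ ≤ max M 0 * ‖z - w‖ :=
    (fderiv ℝ f p).le_of_opNorm_le ((hM p hp).trans (le_max_left _ _)) _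
  calc ‖f z - f w‖ = ‖(f z - f w - fderiv ℝ f p (z - w)) + fderiv ℝ f p (z - w)‖ := by
        rw [sub_add_cancel]
    _ ≤ _ := norm_add_le _ _
    _ ≤ (1 + max M 0) * ‖z - w‖ := by linarith

/-- The radial retraction of a normed space onto the closed ball of radius `r > 0` about `0`, given
by one formula inside and outside the ball. -/
noncomputable def radialRetraction (r : ℝ) (z : E) : E := (r / max r ‖z‖) • z

theorem radialRetraction_eq_self {r : ℝ} (hr : 0 < r) {z : E} (hz : ‖z‖ ≤ r) :
    radialRetraction r z = z := by
  rw [radialRetraction, max_eq_left hz, div_self hr.ne', one_smul]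

theorem norm_radialRetraction_le {r : ℝ} (hr : 0 < r) (z : E) : ‖radialRetraction r z‖ ≤ r := by
  have hm : 0 < max r ‖z‖ := lt_max_of_lt_left hr
  rw [radialRetraction, norm_smul, Real.norm_of_nonneg (by positivity), div_mul_eq_mul_div,
    div_le_iff₀ hm]
  exact mul_le_mul_of_nonneg_left (le_max_right _ _) hr.le

/-- The radial retraction is Lipschitz with constant `2`. -/
theorem norm_radialRetraction_sub_le {r : ℝ} (hr : 0 < r) (z w : E) :
    ‖radialRetraction r z - radialRetraction r w‖ ≤ 2 * ‖z - w‖ := by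
  have hz : 0 < max r ‖z‖ := lt_max_of_lt_left hr
  have hw : 0 < max r ‖w‖ := lt_max_of_lt_left hr
  have h1 : ‖(r / max r ‖z‖) • (z - w)‖ ≤ ‖z - w‖ := by
    rw [norm_smul, Real.norm_of_nonneg (by positivity)]
    exact mul_le_of_le_one_left (norm_nonneg _) ((div_le_one hz).2 (le_max_left _ _))
  have h2 : ‖(r / max r ‖z‖ - r / max r ‖w‖) • w‖ ≤ ‖z - w‖ := by
    have h3 : r / max r ‖z‖ - r / max r ‖w‖ =
        r / max r ‖z‖ * (max r ‖w‖ - max r ‖z‖) / max r ‖w‖ := by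
      field_simp
    have h4 : |max r ‖w‖ - max r ‖z‖| ≤ ‖z - w‖ := by
      rw [abs_sub_comm]
      refine (abs_max_sub_max_le_max _ _ _ _).trans ?_
      simpa using abs_norm_sub_norm_le z w
    have h5 : r / max r ‖z‖ ≤ 1 := (div_le_one hz).2 (le_max_left _ _)
    rw [norm_smul, Real.norm_eq_abs, h3, abs_div, abs_mul, abs_of_pos hw,
      abs_of_nonneg (by positivity : 0 ≤ r / max r ‖z‖), div_mul_eq_mul_div, div_le_iff₀ hw]
    exact mul_le_mul ((mul_le_of_le_one_left (abs_nonneg _) h5).trans h4) (le_max_right _ _)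
      (norm_nonneg _) (norm_nonneg _)
  calc ‖radialRetraction r z - radialRetraction r w‖
      = ‖(r / max r ‖z‖) • (z - w) + (r / max r ‖z‖ - r / max r ‖w‖) • w‖ := by
        rw [radialRetraction, radialRetraction, smul_sub, sub_smul]; congr 1; abel
    _ ≤ _ := norm_add_le _ _
    _ ≤ 2 * ‖z - w‖ := by linarith

theorem continuous_radialRetraction {r : ℝ} (hr : 0 < r) :
    Continuous (radialRetraction r : E → E) :=
  (LipschitzWith.of_dist_le_mul (K := 2) fun z w ↦ by
    rw [dist_eq_norm, dist_eq_norm]; exact norm_radialRetraction_sub_le hr z w).continuous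

/-- Integrability of `t ↦ A t (w t)` for continuous `A` and integrable `w`. -/
theorem IntervalIntegrable.clm_apply_of_continuousOn {A : ℝ → E →L[ℝ] F} {w : ℝ → E} {a b : ℝ}
    (hw : IntervalIntegrable w volume a b) (hA : ContinuousOn A (uIcc a b)) :
    IntervalIntegrable (fun t ↦ A t (w t)) volume a b := by
  obtain ⟨M, hM⟩ := isCompact_uIcc.exists_bound_of_continuousOn hA
  rw [intervalIntegrable_iff] at hw ⊢
  refine (hw.norm.const_mul M).mono' ?_ ?_
  · have := ((hA.mono uIoc_subset_uIcc).aestronglyMeasurable measurableSet_uIoc (μ := volume))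
    exact (ContinuousLinearMap.id ℝ (E →L[ℝ] F)).aestronglyMeasurable_comp₂ this hw.1
  · filter_upwards [ae_restrict_mem measurableSet_uIoc] with t ht
    exact (A t).le_of_opNorm_le (hM t (uIoc_subset_uIcc ht)) _

end UniformDifferentiability

/-! ### Perturbed trajectories -/

namespace ControlProblem

variable {n m : ℕ} {P : ControlProblem n m}

/-- The change of the state equation's right-hand side, split into the effects of the state, of the
control, and of both together. -/
theorem dyn_sub_dyn (P : ControlProblem n m) (y x : Euc n) (w u : Euc m) :
    P.dyn y w - P.dyn x u = (P.f y - P.f x) + (P.g y - P.g x) u + (P.g y - P.g x) (w - u) +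
      P.g x (w - u) := by
  simp only [dyn, _root_.sub_apply, map_sub]
  abel

theorem IsTrajectory.continuousOn {u : ℝ → Euc m} {x : ℝ → Euc n} (hx : P.IsTrajectory u x)
    (ht : P.t₀ ≤ P.tf) : ContinuousOn x (Icc P.t₀ P.tf) := by
  have := hx.2.2.1.continuousOn
  rwa [uIcc_of_le ht] at this

theorem intervalIntegrable_dyn (ht : P.t₀ ≤ P.tf)
    (hf : ContinuousOn P.f P.X) (hg : ContinuousOn P.g P.X) {u : ℝ → Euc m} {x : ℝ → Euc n}
    (hu : IntervalIntegrable u volume P.t₀ P.tf) (hx : ContinuousOn x (Icc P.t₀ P.tf))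
    (hxX : MapsTo x (Icc P.t₀ P.tf) P.X) :
    IntervalIntegrable (fun t ↦ P.dyn (x t) (u t)) volume P.t₀ P.tf := by
  rw [← uIcc_of_le ht] at hx hxX
  exact (hf.comp hx hxX).intervalIntegrable.add (hu.clm_apply_of_continuousOn (hg.comp hx hxX))

theorem IsTrajectory.integral_eq_sub (ht : P.t₀ ≤ P.tf)
    (hf : ContinuousOn P.f P.X) (hg : ContinuousOn P.g P.X) {u : ℝ → Euc m} {x : ℝ → Euc n}
    (hu : IntervalIntegrable u volume P.t₀ P.tf) (hx : P.IsTrajectory u x) {s t : ℝ}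
    (hs : s ∈ Icc P.t₀ P.tf) (ht' : t ∈ Icc P.t₀ P.tf) :
    ∫ r in s..t, P.dyn (x r) (u r) = x t - x s := by
  have hx' := hx.2.2.2
  rw [ae_restrict_iff' measurableSet_Icc] at hx'
  rw [← uIcc_of_le ht] at hs ht' hx'
  exact hx.2.2.1.integral_eq_sub (intervalIntegrable_dyn ht hf hg hu (hx.continuousOn ht) hx.1)
    hx' hs ht'

/-- A control close in `L¹` to a control with a trajectory has itself a trajectory on the whole
time interval, and the distance of the trajectories is bounded by the `L¹` distance of the
controls. The equation is solved with the state retracted to a tube around the given trajectory; by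
the estimate the solution stays in the tube, where the retraction has no effect. -/
theorem IsTrajectory.exists_nearby_trajectory (ht : P.t₀ ≤ P.tf) (hX : IsOpen P.X)
    (hf : ContDiffOn ℝ 1 P.f P.X) (hg : ContDiffOn ℝ 1 P.g P.X) {u : ℝ → Euc m} {x : ℝ → Euc n}
    (hu : IntervalIntegrable u volume P.t₀ P.tf) (hx : P.IsTrajectory u x) :
    ∃ C ≥ 0, ∃ ε > 0, ∀ w : ℝ → Euc m, IntervalIntegrable w volume P.t₀ P.tf →
      ∫ t in P.t₀..P.tf, ‖w t - u t‖ ≤ ε →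
      ∃ y, P.IsTrajectory w y ∧
        ∀ t ∈ Icc P.t₀ P.tf, ‖y t - x t‖ ≤ C * ∫ s in P.t₀..P.tf, ‖w s - u s‖ := by
  have hI : uIcc P.t₀ P.tf = Icc P.t₀ P.tf := uIcc_of_le ht
  have hxc := hx.continuousOn ht
  have hK : IsCompact (x '' Icc P.t₀ P.tf) := isCompact_Icc.image_of_continuousOn hxc
  have hKX : x '' Icc P.t₀ P.tf ⊆ P.X := by rintro _ ⟨t, ht, rfl⟩; exact hx.1 t ht
  obtain ⟨L₁, hL₁, ρ₁, hρ₁, h₁⟩ := hf.exists_uniform_lipschitz hX hK hKX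
  obtain ⟨L₂, hL₂, ρ₂, hρ₂, h₂⟩ := hg.exists_uniform_lipschitz hX hK hKX
  obtain ⟨M, hM⟩ := hK.exists_bound_of_continuousOn (hg.continuousOn.mono hKX)
  have hM0 : 0 ≤ M := (norm_nonneg _).trans
    (hM _ (mem_image_of_mem x (left_mem_Icc.2 ht)))
  set ρ := min ρ₁ ρ₂
  have hρ : 0 < ρ := lt_min hρ₁ hρ₂
  set κ := ((P.tf - P.t₀) * (2 * L₁) + 2 * L₂ * ((∫ t in P.t₀..P.tf, ‖u t‖) + 1)) with hκ
  set C := 2 * Real.exp (2 * κ) * M with hC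
  have hC0 : 0 ≤ C := by positivity
  -- `‖w - u‖₁ ≤ 1` bounds the integrated Lipschitz constant by `κ`, uniformly in `w`, and
  -- `‖w - u‖₁ ≤ ρ / (C + 1)` keeps the perturbed trajectory in the tube of radius `ρ`
  refine ⟨C, hC0, min 1 (ρ / (C + 1)), by positivity, fun w hw hwu ↦ ?_⟩
  have hd0 : 0 ≤ ∫ s in P.t₀..P.tf, ‖w s - u s‖ :=
    intervalIntegral.integral_nonneg ht fun _ _ ↦ norm_nonneg _
  have hmem : ∀ t ∈ Icc P.t₀ P.tf, ∀ z : Euc n,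
      x t + radialRetraction ρ z ∈ Metric.closedBall (x t) ρ := fun t _ z ↦ by
    simpa using norm_radialRetraction_le hρ z
  have hmem₁ : ∀ t ∈ Icc P.t₀ P.tf, ∀ z : Euc n,
      x t + radialRetraction ρ z ∈ Metric.closedBall (x t) ρ₁ := fun t ht z ↦
    Metric.closedBall_subset_closedBall (min_le_left _ _) (hmem t ht z)
  have hmem₂ : ∀ t ∈ Icc P.t₀ P.tf, ∀ z : Euc n,
      x t + radialRetraction ρ z ∈ Metric.closedBall (x t) ρ₂ := fun t ht z ↦
    Metric.closedBall_subset_closedBall (min_le_right _ _) (hmem t ht z)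
  have hmemX : ∀ t ∈ Icc P.t₀ P.tf, ∀ z : Euc n, x t + radialRetraction ρ z ∈ P.X :=
    fun t ht z ↦ (h₁ _ (mem_image_of_mem x ht)).1 (hmem₁ t ht z)
  have hIw : IntervalIntegrable (fun t ↦ ‖w t‖) volume P.t₀ P.tf := hw.norm
  -- the equation for the difference of the trajectories, with the state retracted to a tube
  -- around `x` on which `f` and `g` are Lipschitz
  obtain ⟨δ, hδc, hδ, hδb⟩ := exists_integral_equation_solution
    (G := fun t z ↦ P.dyn (x t + radialRetraction ρ z) (w t) - P.dyn (x t) (u t))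
    (k := fun t ↦ 2 * L₁ + 2 * L₂ * ‖w t‖) ht 0
    (intervalIntegrable_const.add (hIw.const_mul _)) (fun t _ ↦ by positivity)
    (fun t ht z z' ↦ by
      have e : P.dyn (x t + radialRetraction ρ z) (w t) - P.dyn (x t) (u t) -
          (P.dyn (x t + radialRetraction ρ z') (w t) - P.dyn (x t) (u t)) =
          (P.f (x t + radialRetraction ρ z) - P.f (x t + radialRetraction ρ z')) +
          (P.g (x t + radialRetraction ρ z) - P.g (x t + radialRetraction ρ z')) (w t) := by
        simp only [dyn, _root_.sub_apply]; abel
      have hs : ‖(x t + radialRetraction ρ z) - (x t + radialRetraction ρ z')‖ ≤ 2 * ‖z - z'‖ := by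
        rw [add_sub_add_left_eq_sub]; exact norm_radialRetraction_sub_le hρ z z'
      have a1 := (h₁ _ (mem_image_of_mem x ht)).2 _ (hmem₁ t ht z) _ (hmem₁ t ht z')
      have a2 := (h₂ _ (mem_image_of_mem x ht)).2 _ (hmem₂ t ht z) _ (hmem₂ t ht z')
      rw [e]
      calc _ ≤ _ := norm_add_le _ _
        _ ≤ L₁ * (2 * ‖z - z'‖) + (L₂ * (2 * ‖z - z'‖)) * ‖w t‖ := by
          refine add_le_add (a1.trans (mul_le_mul_of_nonneg_left hs hL₁)) ?_
          exact ContinuousLinearMap.le_of_opNorm_le _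
            (a2.trans (mul_le_mul_of_nonneg_left hs hL₂)) _
        _ = _ := by ring)
    (fun z hz ↦ by
      have hc : ContinuousOn (fun t ↦ x t + radialRetraction ρ (z t)) (Icc P.t₀ P.tf) :=
        hxc.add ((continuous_radialRetraction hρ).comp_continuousOn hz)
      exact (intervalIntegrable_dyn ht hf.continuousOn hg.continuousOn hw hc
        fun t ht ↦ hmemX t ht _).sub
        (intervalIntegrable_dyn ht hf.continuousOn hg.continuousOn hu hxc hx.1))
  have hr0 : radialRetraction ρ (0 : Euc n) = 0 := by simp [radialRetraction]
  have hδ' : ∀ t ∈ Icc P.t₀ P.tf, ‖δ t‖ ≤ C * ∫ s in P.t₀..P.tf, ‖w s - u s‖ := fun t h ↦ by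
    have h3 : ∫ s in P.t₀..P.tf, ‖P.dyn (x s + radialRetraction ρ 0) (w s) - P.dyn (x s) (u s)‖ ≤
        M * ∫ s in P.t₀..P.tf, ‖w s - u s‖ := by
      rw [← intervalIntegral.integral_const_mul]
      have hi : IntervalIntegrable (fun s ↦ P.g (x s) (w s - u s)) volume P.t₀ P.tf :=
        (hw.sub hu).clm_apply_of_continuousOn (hI ▸ hg.continuousOn.comp hxc hx.1)
      have e : ∀ s, P.dyn (x s + radialRetraction ρ 0) (w s) - P.dyn (x s) (u s) =
          P.g (x s) (w s - u s) := fun s ↦ by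
        rw [hr0, add_zero, dyn_sub_dyn]; simp
      simp only [e]
      exact intervalIntegral.integral_mono_on ht hi.norm ((hw.sub hu).norm.const_mul M)
        fun s hs ↦ (P.g (x s)).le_of_opNorm_le (hM _ (mem_image_of_mem x hs)) _
    have h4 : ∫ s in P.t₀..P.tf, (2 * L₁ + 2 * L₂ * ‖w s‖) ≤ κ := by
      rw [intervalIntegral.integral_add intervalIntegrable_const (hIw.const_mul _),
        intervalIntegral.integral_const, intervalIntegral.integral_const_mul, hκ, smul_eq_mul]
      have : ∫ s in P.t₀..P.tf, ‖w s‖ ≤ (∫ t in P.t₀..P.tf, ‖u t‖) + 1 := by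
        calc _ ≤ ∫ s in P.t₀..P.tf, (‖u s‖ + ‖w s - u s‖) :=
              intervalIntegral.integral_mono_on ht hIw (hu.norm.add (hw.sub hu).norm)
                fun s _ ↦ by
                  have := norm_add_le (u s) (w s - u s)
                  rwa [add_sub_cancel] at this
          _ = _ := intervalIntegral.integral_add hu.norm (hw.sub hu).norm
          _ ≤ _ := by
            have := hwu.trans (min_le_left _ _)
            linarith
      gcongr
    have h5 := hδb t h
    rw [sub_zero] at h5
    calc ‖δ t‖ ≤ _ := h5
      _ ≤ 2 * Real.exp (2 * κ) * (M * ∫ s in P.t₀..P.tf, ‖w s - u s‖) := by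
        gcongr
        exact intervalIntegral.integral_nonneg ht fun _ _ ↦ norm_nonneg _
      _ = _ := by rw [hC]; ring
  -- the retraction is inactive along the solution
  have hδρ : ∀ t ∈ Icc P.t₀ P.tf, ‖δ t‖ ≤ ρ := fun t h ↦ by
    calc ‖δ t‖ ≤ _ := hδ' t h
      _ ≤ C * (ρ / (C + 1)) := by
        gcongr; exact hwu.trans (min_le_right _ _)
      _ ≤ (C + 1) * (ρ / (C + 1)) := by gcongr; linarith
      _ = ρ := by field_simp
  have hy : ∀ t ∈ Icc P.t₀ P.tf, x t + δ t ∈ P.X := fun t h ↦ by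
    rw [← radialRetraction_eq_self hρ (hδρ t h)]; exact hmemX t h _
  have hyi : IntervalIntegrable (fun t ↦ P.dyn (x t + δ t) (w t)) volume P.t₀ P.tf :=
    intervalIntegrable_dyn ht hf.continuousOn hg.continuousOn hw (hxc.add hδc) hy
  have hyeq : ∀ t ∈ Icc P.t₀ P.tf,
      x t + δ t = P.x₀ + ∫ s in P.t₀..t, P.dyn (x s + δ s) (w s) := fun t h ↦ by
    have h0 : P.t₀ ∈ Icc P.t₀ P.tf := left_mem_Icc.2 ht
    have e1 := hx.integral_eq_sub ht hf.continuousOn hg.continuousOn hu h0 h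
    have e2 : δ t = ∫ s in P.t₀..t, (P.dyn (x s + δ s) (w s) - P.dyn (x s) (u s)) := by
      rw [hδ t h, zero_add]
      refine intervalIntegral.integral_congr fun s hs ↦ ?_
      rw [uIcc_of_le h.1] at hs
      have hs' : s ∈ Icc P.t₀ P.tf := ⟨hs.1, hs.2.trans h.2⟩
      simp only [radialRetraction_eq_self hρ (hδρ s hs')]
    rw [intervalIntegral.integral_sub (hyi.mono_uIcc left_mem_uIcc (hI ▸ h))
      ((intervalIntegrable_dyn ht hf.continuousOn hg.continuousOn hu hxc hx.1).mono_uIcc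
        left_mem_uIcc (hI ▸ h)), e1, hx.2.1] at e2
    rw [e2]; abel
  refine ⟨fun t ↦ x t + δ t, ⟨hy, ?_, ?_⟩, fun t h ↦ by simpa using hδ' t h⟩
  · simpa using hyeq P.t₀ (left_mem_Icc.2 ht)
  · exact absolutelyContinuousOnInterval_of_integral_eq ht (left_mem_Icc.2 ht) hyi hyeq

end ControlProblem

/-! ### Linear equations and the co-state -/

theorem IntervalIntegrable.comp_add_sub {F : Type*} [NormedAddCommGroup F] {φ : ℝ → F} {a b : ℝ}
    (h : IntervalIntegrable φ volume a b) :
    IntervalIntegrable (fun t ↦ φ (a + b - t)) volume a b := by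
  simpa using (h.comp_sub_left (a + b)).symm

section LinearEquation

variable {E : Type*} [NormedAddCommGroup E] [NormedSpace ℝ E] [CompleteSpace E]

/-- A linear equation with integrable coefficients has a solution with prescribed value at the
right end point of the interval, by reversing time. -/
theorem exists_linear_equation_solution {β : ℝ → E} {B : ℝ → E →L[ℝ] E} {a b : ℝ} (hab : a ≤ b)
    (hβ : IntervalIntegrable β volume a b) (hB : IntervalIntegrable B volume a b) (l₀ : E) :
    ∃ l : ℝ → E, IntervalIntegrable (fun t ↦ β t + B t (l t)) volume a b ∧
      ∀ t ∈ Icc a b, l t = l₀ + ∫ s in b..t, (β s + B s (l s)) := by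
  have hrev : ∀ t ∈ Icc a b, a + b - t ∈ Icc a b := fun t ht ↦
    ⟨by linarith [ht.2], by linarith [ht.1]⟩
  have happ : ∀ z : ℝ → E, ContinuousOn z (Icc a b) →
      IntervalIntegrable (fun t ↦ B t (z t)) volume a b := fun z hz ↦ by
    refine IntervalIntegrable.clm_apply_of_continuousOn
      (A := fun t ↦ ContinuousLinearMap.apply ℝ E (z t)) hB ?_
    rw [uIcc_of_le hab]
    exact (ContinuousLinearMap.apply ℝ E).continuous.comp_continuousOn hz
  -- solve the equation for `t ↦ l (a + b - t)` forwards in time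
  obtain ⟨y, hyc, hy, -⟩ := exists_integral_equation_solution
    (G := fun t z ↦ -(β (a + b - t) + B (a + b - t) z)) (k := fun t ↦ ‖B (a + b - t)‖) hab l₀
    hB.norm.comp_add_sub (fun t _ ↦ norm_nonneg _)
    (fun t _ z w ↦ by
      rw [neg_sub_neg, add_sub_add_left_eq_sub, ← map_sub, norm_sub_rev z w]
      exact (B _).le_opNorm _)
    (fun z hz ↦ by
      have h := happ (fun t ↦ z (a + b - t))
        (hz.comp (by fun_prop) fun t ht ↦ hrev t ht)
      have := (hβ.add h).comp_add_sub
      simp only [sub_sub_cancel] at this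
      exact this.neg)
  have hlc : ContinuousOn (fun t ↦ y (a + b - t)) (Icc a b) :=
    hyc.comp (by fun_prop) fun t ht ↦ hrev t ht
  refine ⟨fun t ↦ y (a + b - t), hβ.add (happ _ hlc), fun t ht ↦ ?_⟩
  simp only [hy _ (hrev t ht), add_right_inj]
  have := intervalIntegral.integral_comp_sub_left (a := a) (b := a + b - t)
    (fun s ↦ β s + B s (y (a + b - s))) (a + b)
  simp only [sub_sub_cancel, add_sub_cancel_left] at this
  rw [intervalIntegral.integral_neg, this, intervalIntegral.integral_symm, neg_neg]

end LinearEquation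

section Inner

variable {E : Type*} [NormedAddCommGroup E] [InnerProductSpace ℝ E]

theorem AbsolutelyContinuousOnInterval.real_inner {f g : ℝ → E} {a b : ℝ}
    (hf : AbsolutelyContinuousOnInterval f a b) (hg : AbsolutelyContinuousOnInterval g a b) :
    AbsolutelyContinuousOnInterval (fun t ↦ inner ℝ (f t) (g t)) a b := by
  obtain ⟨C, hC⟩ := hf.exists_bound
  obtain ⟨D, hD⟩ := hg.exists_bound
  refine hf.of_dist_le (C := D) (D := C) hg fun s hs t ht ↦ ?_
  have e : inner ℝ (f s) (g s) - inner ℝ (f t) (g t) =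
      inner ℝ (f s - f t) (g s) + inner ℝ (f t) (g s - g t) := by
    rw [inner_sub_left, inner_sub_right]; ring
  rw [Real.dist_eq, e, dist_eq_norm, dist_eq_norm]
  refine (abs_add_le _ _).trans (add_le_add ?_ ?_)
  · rw [mul_comm D]
    exact (abs_real_inner_le_norm _ _).trans (mul_le_mul_of_nonneg_left (hD s hs) (norm_nonneg _))
  · exact (abs_real_inner_le_norm _ _).trans (mul_le_mul_of_nonneg_right (hC t ht) (norm_nonneg _))

theorem IntervalIntegrable.inner_of_continuousOn {f g : ℝ → E} {a b : ℝ}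
    (hg : IntervalIntegrable g volume a b) (hf : ContinuousOn f (uIcc a b)) :
    IntervalIntegrable (fun t ↦ inner ℝ (f t) (g t)) volume a b :=
  hg.clm_apply_of_continuousOn (A := fun t ↦ innerSL ℝ (f t))
    ((innerSL ℝ).continuous.comp_continuousOn hf)

/-- Integration by parts for the inner product of two absolutely continuous functions. -/
theorem AbsolutelyContinuousOnInterval.integral_inner_eq_sub [CompleteSpace E]
    {f g f' g' : ℝ → E} {a b : ℝ}
    (hf : AbsolutelyContinuousOnInterval f a b) (hg : AbsolutelyContinuousOnInterval g a b)
    (hfi : IntervalIntegrable f' volume a b) (hgi : IntervalIntegrable g' volume a b)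
    (hf' : ∀ᵐ t, t ∈ uIcc a b → HasDerivAt f (f' t) t)
    (hg' : ∀ᵐ t, t ∈ uIcc a b → HasDerivAt g (g' t) t) :
    ∫ t in a..b, (inner ℝ (f t) (g' t) + inner ℝ (f' t) (g t)) =
      inner ℝ (f b) (g b) - inner ℝ (f a) (g a) := by
  refine (hf.real_inner hg).integral_eq_sub ((hgi.inner_of_continuousOn hf.continuousOn).add ?_) ?_
    left_mem_uIcc right_mem_uIcc
  · simp_rw [real_inner_comm]
    exact hfi.inner_of_continuousOn hg.continuousOn
  · filter_upwards [hf', hg'] with t h1 h2 ht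
    exact (h1 ht).inner ℝ (h2 ht)

end Inner

namespace ControlProblem

variable {n m : ℕ} {P : ControlProblem n m}

/-- The derivative of the state equation's right-hand side with respect to the state, as the sum of
the derivative of the drift and the derivative of `g` with `u` inserted in its second argument. -/
noncomputable def dynDeriv (P : ControlProblem n m) (x : Euc n) (u : Euc m) : Euc n →L[ℝ] Euc n :=
  fderiv ℝ P.f x + (fderiv ℝ P.g x).flip u

theorem dynDeriv_apply (x z : Euc n) (u : Euc m) :
    P.dynDeriv x u z = fderiv ℝ P.f x z + fderiv ℝ P.g x z u := rfl

theorem hasFDerivAt_dyn {x : Euc n} (hf : DifferentiableAt ℝ P.f x)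
    (hg : DifferentiableAt ℝ P.g x) (u : Euc m) :
    HasFDerivAt (fun z ↦ P.dyn z u) (P.dynDeriv x u) x := by
  refine hf.hasFDerivAt.add ?_
  have := (ContinuousLinearMap.apply ℝ (Euc n) u).hasFDerivAt.comp x hg.hasFDerivAt
  exact this

theorem intervalIntegrable_dynDeriv (ht : P.t₀ ≤ P.tf) (hX : IsOpen P.X)
    (hf : ContDiffOn ℝ 1 P.f P.X) (hg : ContDiffOn ℝ 1 P.g P.X) {u : ℝ → Euc m} {x : ℝ → Euc n}
    (hu : IntervalIntegrable u volume P.t₀ P.tf) (hx : ContinuousOn x (Icc P.t₀ P.tf))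
    (hxX : MapsTo x (Icc P.t₀ P.tf) P.X) :
    IntervalIntegrable (fun t ↦ P.dynDeriv (x t) (u t)) volume P.t₀ P.tf := by
  rw [← uIcc_of_le ht] at hx hxX
  refine ((hf.continuousOn_fderiv_of_isOpen_one hX).comp hx hxX).intervalIntegrable.add
    (hu.clm_apply_of_continuousOn (A := fun t ↦ (fderiv ℝ P.g (x t)).flip) ?_)
  exact (ContinuousLinearMap.flipₗᵢ ℝ (Euc n) (Euc m) (Euc n)).continuous.comp_continuousOn
    ((hg.continuousOn_fderiv_of_isOpen_one hX).comp hx hxX)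

/-- The right-hand side `-∇q x - (∂ₓ (f + g u))ᵀ l` of the co-state equation, in terms of
`dynDeriv`. It equals `-∇ₓ H` at states in `X`, where `f`, `g` and `q` are differentiable
(`neg_gradient_hamiltonian_state`). -/
noncomputable def costateRhs (P : ControlProblem n m) (x : Euc n) (u : Euc m) (l : Euc n) : Euc n :=
  -gradient P.q x - ContinuousLinearMap.adjoint (P.dynDeriv x u) l

theorem inner_costateRhs (x l z : Euc n) (u : Euc m) :
    inner ℝ (P.costateRhs x u l) z = -fderiv ℝ P.q x z - inner ℝ l (P.dynDeriv x u z) := by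
  rw [costateRhs, inner_sub_left, inner_neg_left, ContinuousLinearMap.adjoint_inner_left, gradient,
    InnerProductSpace.toDual_symm_apply]

theorem continuousOn_gradient_q (hX : IsOpen P.X) (hq : ContDiffOn ℝ 1 P.q P.X) :
    ContinuousOn (gradient P.q) P.X :=
  (InnerProductSpace.toDual ℝ (Euc n)).symm.continuous.comp_continuousOn
    (hq.continuousOn_fderiv_of_isOpen_one hX)

/-- Existence of the co-state with given terminal value. -/
theorem exists_costate (ht : P.t₀ ≤ P.tf) (hX : IsOpen P.X)
    (hf : ContDiffOn ℝ 1 P.f P.X) (hg : ContDiffOn ℝ 1 P.g P.X) (hq : ContDiffOn ℝ 1 P.q P.X)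
    {u : ℝ → Euc m} {x : ℝ → Euc n}
    (hu : IntervalIntegrable u volume P.t₀ P.tf) (hx : P.IsTrajectory u x) (l₀ : Euc n) :
    ∃ l : ℝ → Euc n, l P.tf = l₀ ∧
      IntervalIntegrable (fun t ↦ P.costateRhs (x t) (u t) (l t)) volume P.t₀ P.tf ∧
      IsCaratheodorySolution (fun t k ↦ P.costateRhs (x t) (u t) k) P.t₀ P.tf l := by
  have hxc := hx.continuousOn ht
  have hβ : IntervalIntegrable (fun t ↦ -gradient P.q (x t)) volume P.t₀ P.tf :=
    (((continuousOn_gradient_q hX hq).comp hxc hx.1).neg.intervalIntegrable_of_Icc ht)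
  have hB : IntervalIntegrable
      (fun t ↦ -ContinuousLinearMap.adjoint (P.dynDeriv (x t) (u t))) volume P.t₀ P.tf := by
    have h := intervalIntegrable_dynDeriv ht hX hf hg hu hxc hx.1
    rw [intervalIntegrable_iff] at h ⊢
    exact (((ContinuousLinearMap.adjoint (𝕜 := ℝ) (E := Euc n) (F := Euc n)).toContinuousLinearEquiv
      : (Euc n →L[ℝ] Euc n) →L⋆[ℝ] (Euc n →L[ℝ] Euc n)).integrable_comp h).neg
  obtain ⟨l, hli, hl⟩ := exists_linear_equation_solution ht hβ hB l₀
  have e : ∀ t, -gradient P.q (x t) + (-ContinuousLinearMap.adjoint (P.dynDeriv (x t) (u t))) (l t)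
      = P.costateRhs (x t) (u t) (l t) := fun t ↦ by
    rw [costateRhs, _root_.neg_apply, sub_eq_add_neg]
  simp only [e] at hli hl
  exact ⟨l, by simpa using hl P.tf (right_mem_Icc.2 ht), hli,
    absolutelyContinuousOnInterval_of_integral_eq ht (right_mem_Icc.2 ht) hli hl⟩

end ControlProblem

/-! ### First-order expansion of the cost -/

namespace ControlProblem

variable {n m : ℕ} {P : ControlProblem n m}

/-- The drift and the state cost drop out of the difference of two Hamiltonians at one state. -/
theorem hamiltonian_sub_hamiltonian (x l : Euc n) (w u : Euc m) :
    P.hamiltonian x l w - P.hamiltonian x l u = P.c w - P.c u + inner ℝ l (P.g x (w - u)) := by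
  simp only [hamiltonian, dyn, inner_add_right, map_sub, inner_sub_right]
  ring

theorem intervalIntegrable_hamiltonian_sub (ht : P.t₀ ≤ P.tf) (hg : ContinuousOn P.g P.X)
    {u w : ℝ → Euc m} {x l : ℝ → Euc n}
    (hu : IntervalIntegrable u volume P.t₀ P.tf) (hw : IntervalIntegrable w volume P.t₀ P.tf)
    (hcu : IntervalIntegrable (fun t ↦ P.c (u t)) volume P.t₀ P.tf)
    (hcw : IntervalIntegrable (fun t ↦ P.c (w t)) volume P.t₀ P.tf)
    (hx : ContinuousOn x (Icc P.t₀ P.tf)) (hxX : MapsTo x (Icc P.t₀ P.tf) P.X)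
    (hl : ContinuousOn l (Icc P.t₀ P.tf)) :
    IntervalIntegrable (fun t ↦ P.hamiltonian (x t) (l t) (w t) - P.hamiltonian (x t) (l t) (u t))
      volume P.t₀ P.tf := by
  simp only [hamiltonian_sub_hamiltonian]
  rw [← uIcc_of_le ht] at hx hxX hl
  exact (hcw.sub hcu).add
    (((hw.sub hu).clm_apply_of_continuousOn (hg.comp hx hxX)).inner_of_continuousOn hl)

/-- First-order expansion of the cost along nearby trajectories: up to terms of higher order, the
cost changes at most by the integrated difference of the Hamiltonians on the reference trajectory.
The remainder is small compared to the distance `δ` of the trajectories; its constants `N` and `Λ`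
do not depend on the accuracy `η`. -/
theorem exists_cost_sub_le (ht : P.t₀ ≤ P.tf) (hX : IsOpen P.X)
    (hf : ContDiffOn ℝ 1 P.f P.X) (hg : ContDiffOn ℝ 1 P.g P.X) (hq : ContDiffOn ℝ 1 P.q P.X)
    (hΦ : DifferentiableOn ℝ P.Φ P.X) {u : ℝ → Euc m} {x l : ℝ → Euc n}
    (hu : P.IsControl u) (hx : P.IsTrajectory u x) (hltf : l P.tf = gradient P.Φ (x P.tf))
    (hli : IntervalIntegrable (fun t ↦ P.costateRhs (x t) (u t) (l t)) volume P.t₀ P.tf)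
    (hl : IsCaratheodorySolution (fun t k ↦ P.costateRhs (x t) (u t) k) P.t₀ P.tf l) :
    ∃ N ≥ 0, ∃ Λ ≥ 0, ∀ η > 0, ∃ ε > 0, ∀ w y, P.IsControl w → P.IsTrajectory w y →
      ∀ δ ≥ 0, δ ≤ ε →
      (∀ t ∈ Icc P.t₀ P.tf, ‖y t - x t‖ ≤ δ) →
      P.cost w y - P.cost u x ≤
        (∫ t in P.t₀..P.tf, (P.hamiltonian (x t) (l t) (w t) - P.hamiltonian (x t) (l t) (u t))) +
          δ * (η * N + Λ * ∫ t in P.t₀..P.tf, ‖w t - u t‖) := by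
  have hI : uIcc P.t₀ P.tf = Icc P.t₀ P.tf := uIcc_of_le ht
  have hxc := hx.continuousOn ht
  have hlc : ContinuousOn l (Icc P.t₀ P.tf) := hI ▸ hl.1.continuousOn
  have hK : IsCompact (x '' Icc P.t₀ P.tf) := isCompact_Icc.image_of_continuousOn hxc
  have hKX : x '' Icc P.t₀ P.tf ⊆ P.X := by rintro _ ⟨t, ht, rfl⟩; exact hx.1 t ht
  have hright : P.tf ∈ Icc P.t₀ P.tf := right_mem_Icc.2 ht
  obtain ⟨L, hL, ρ, hρ, hLip⟩ := hg.exists_uniform_lipschitz hX hK hKX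
  obtain ⟨B, hB⟩ := hl.1.exists_bound
  rw [hI] at hB
  have hB0 : 0 ≤ B := (norm_nonneg _).trans (hB _ hright)
  have hnu : IntervalIntegrable (fun t ↦ ‖u t‖) volume P.t₀ P.tf := hu.2.1.norm
  have hNi : IntervalIntegrable (fun t ↦ 1 + B * (1 + ‖u t‖)) volume P.t₀ P.tf :=
    intervalIntegrable_const.add ((intervalIntegrable_const.add hnu).const_mul B)
  have hN0 : 0 ≤ ∫ t in P.t₀..P.tf, (1 + B * (1 + ‖u t‖)) :=
    intervalIntegral.integral_nonneg ht fun t _ ↦ by positivity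
  refine ⟨1 + ∫ t in P.t₀..P.tf, (1 + B * (1 + ‖u t‖)), by positivity, B * L, by positivity,
    fun η hη ↦ ?_⟩
  obtain ⟨ρf, hρf, hfa⟩ := hf.exists_uniform_fderiv_approx hX hK hKX hη
  obtain ⟨ρg, hρg, hga⟩ := hg.exists_uniform_fderiv_approx hX hK hKX hη
  obtain ⟨ρq, hρq, hqa⟩ := hq.exists_uniform_fderiv_approx hX hK hKX hη
  have hΦd := (hΦ.differentiableAt (hX.mem_nhds (hx.1 _ hright))).hasFDerivAt
  obtain ⟨ρΦ, hρΦ, hΦa⟩ := Metric.eventually_nhds_iff_ball.1 (hΦd.isLittleO.def hη)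
  refine ⟨min (min ρ ρf) (min (min ρg ρq) (ρΦ / 2)), by positivity,
    fun w y hw hy δ hδ0 hδ hyx ↦ ?_⟩
  simp only [le_min_iff] at hδ
  obtain ⟨⟨h1, h2⟩, ⟨h3, h4⟩, h5⟩ := hδ
  have hyc := hy.continuousOn ht
  have hmem : ∀ r, δ ≤ r → ∀ t ∈ Icc P.t₀ P.tf, y t ∈ Metric.closedBall (x t) r ∧
      x t ∈ Metric.closedBall (x t) r := fun r hr t ht ↦
    ⟨mem_closedBall_iff_norm.2 ((hyx t ht).trans hr), Metric.mem_closedBall_self (hδ0.trans hr)⟩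
  have hdu := intervalIntegrable_dyn ht hf.continuousOn hg.continuousOn hu.2.1 hxc hx.1
  have hdw := intervalIntegrable_dyn ht hf.continuousOn hg.continuousOn hw.2.1 hyc hy.1
  have hlae := hl.2
  have hxae := hx.2.2.2
  have hyae := hy.2.2.2
  rw [ae_restrict_iff' measurableSet_Icc, ← hI] at hlae hxae hyae
  -- The change of the terminal cost, by parts: `y - x` vanishes at `t₀`, and `l` is the gradient of
  -- `Φ` at `t_f`.
  have hterm : P.Φ (y P.tf) - P.Φ (x P.tf) ≤
      (∫ t in P.t₀..P.tf, (inner ℝ (l t) (P.dyn (y t) (w t) - P.dyn (x t) (u t)) +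
        inner ℝ (P.costateRhs (x t) (u t) (l t)) (y t - x t))) + η * δ := by
    rw [hl.1.integral_inner_eq_sub (hy.2.2.1.fun_sub hx.2.2.1) hli (hdw.sub hdu) hlae (by
      filter_upwards [hxae, hyae] with t h h' ht' using (h' ht').sub (h ht')), hltf, hx.2.1,
      hy.2.1, sub_self, inner_zero_right, sub_zero, gradient,
      InnerProductSpace.toDual_symm_apply]
    have hb : y P.tf ∈ Metric.ball (x P.tf) ρΦ := by
      rw [mem_ball_iff_norm]
      exact (hyx _ hright).trans_lt (h5.trans_lt (half_lt_self hρΦ))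
    have := (Real.le_norm_self _).trans (hΦa _ hb)
    have h6 := mul_le_mul_of_nonneg_left (hyx _ hright) hη.le
    linarith
  have hqi : ∀ {z : ℝ → Euc n}, ContinuousOn z (Icc P.t₀ P.tf) → MapsTo z (Icc P.t₀ P.tf) P.X →
      IntervalIntegrable (fun t ↦ P.q (z t)) volume P.t₀ P.tf := fun hz hzX ↦
    (hq.continuousOn.comp hz hzX).intervalIntegrable_of_Icc ht
  have hHi := intervalIntegrable_hamiltonian_sub ht hg.continuousOn hu.2.1 hw.2.1 hu.2.2 hw.2.2
    hxc hx.1 hlc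
  have hwu : IntervalIntegrable (fun t ↦ ‖w t - u t‖) volume P.t₀ P.tf := (hw.2.1.sub hu.2.1).norm
  have hpi : IntervalIntegrable (fun t ↦
      inner ℝ (l t) (P.dyn (y t) (w t) - P.dyn (x t) (u t)) +
        inner ℝ (P.costateRhs (x t) (u t) (l t)) (y t - x t)) volume P.t₀ P.tf := by
    refine ((hdw.sub hdu).inner_of_continuousOn (hI ▸ hlc)).add ?_
    simp_rw [fun t ↦ real_inner_comm (y t - x t) (P.costateRhs (x t) (u t) (l t))]
    exact hli.inner_of_continuousOn (hI ▸ hyc.sub hxc)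
  have hci : IntervalIntegrable (fun t ↦ (P.q (y t) + P.c (w t)) - (P.q (x t) + P.c (u t)))
      volume P.t₀ P.tf := ((hqi hyc hy.1).add hw.2.2).sub ((hqi hxc hx.1).add hu.2.2)
  -- Pointwise, the co-state equation cancels the terms linear in `y - x`. Taylor remainders and the
  -- product of the variations of state and control are left.
  have hpt : ∀ t ∈ Icc P.t₀ P.tf,
      (inner ℝ (l t) (P.dyn (y t) (w t) - P.dyn (x t) (u t)) +
        inner ℝ (P.costateRhs (x t) (u t) (l t)) (y t - x t)) +
      ((P.q (y t) + P.c (w t)) - (P.q (x t) + P.c (u t))) ≤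
      (P.hamiltonian (x t) (l t) (w t) - P.hamiltonian (x t) (l t) (u t)) +
        (δ * η * (1 + B * (1 + ‖u t‖)) + δ * (B * L) * ‖w t - u t‖) := fun t h ↦ by
    have hp : x t ∈ x '' Icc P.t₀ P.tf := mem_image_of_mem x h
    have hin : ∀ (z : Euc n) (r : ℝ), ‖z‖ ≤ r → inner ℝ (l t) z ≤ B * r := fun z r hz ↦
      (real_inner_le_norm _ _).trans (mul_le_mul (hB t h) hz (norm_nonneg _) hB0)
    have a1 : P.q (y t) - P.q (x t) - fderiv ℝ P.q (x t) (y t - x t) ≤ η * δ :=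
      (Real.le_norm_self _).trans (((hqa _ hp).2 _ (hmem _ h4 t h).1 _ (hmem _ h4 t h).2).trans
        (mul_le_mul_of_nonneg_left (hyx t h) hη.le))
    have a2 := hin (P.f (y t) - P.f (x t) - fderiv ℝ P.f (x t) (y t - x t)) (η * δ)
      (((hfa _ hp).2 _ (hmem _ h2 t h).1 _ (hmem _ h2 t h).2).trans
        (mul_le_mul_of_nonneg_left (hyx t h) hη.le))
    have a3 := hin ((P.g (y t) - P.g (x t) - fderiv ℝ P.g (x t) (y t - x t)) (u t))
      (η * δ * ‖u t‖) (ContinuousLinearMap.le_of_opNorm_le _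
        (((hga _ hp).2 _ (hmem _ h3 t h).1 _ (hmem _ h3 t h).2).trans
          (mul_le_mul_of_nonneg_left (hyx t h) hη.le)) _)
    have a4 := hin ((P.g (y t) - P.g (x t)) (w t - u t)) (L * δ * ‖w t - u t‖)
      (ContinuousLinearMap.le_of_opNorm_le _
        (((hLip _ hp).2 _ (hmem _ h1 t h).1 _ (hmem _ h1 t h).2).trans
          (mul_le_mul_of_nonneg_left (hyx t h) hL)) _)
    rw [hamiltonian_sub_hamiltonian, inner_costateRhs, dyn_sub_dyn, dynDeriv_apply]
    simp only [_root_.sub_apply, inner_add_right, inner_sub_right] at a2 a3 a4 ⊢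
    linarith
  have hint := intervalIntegral.integral_mono_on ht (hpi.add hci)
    (hHi.add ((hNi.const_mul (δ * η)).add (hwu.const_mul (δ * (B * L))))) hpt
  rw [intervalIntegral.integral_add hpi hci, intervalIntegral.integral_add hHi
    ((hNi.const_mul (δ * η)).add (hwu.const_mul (δ * (B * L)))),
    intervalIntegral.integral_add (hNi.const_mul (δ * η)) (hwu.const_mul (δ * (B * L))),
    intervalIntegral.integral_const_mul, intervalIntegral.integral_const_mul,
    intervalIntegral.integral_sub ((hqi hyc hy.1).add hw.2.2) ((hqi hxc hx.1).add hu.2.2)] at hint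
  rw [cost, cost]
  linarith

/-- The first-order optimality condition in `L¹`: near an optimal control the integrated
Hamiltonian can decrease only by an amount that is small compared to the `L¹` distance. Here the
trajectory distance `δ` of the cost expansion is `C` times the `L¹` distance of the controls. -/
theorem IsOptimal.exists_le_integral_hamiltonian_sub (ht : P.t₀ ≤ P.tf) (hX : IsOpen P.X)
    (hf : ContDiffOn ℝ 1 P.f P.X) (hg : ContDiffOn ℝ 1 P.g P.X) (hq : ContDiffOn ℝ 1 P.q P.X)
    (hΦ : DifferentiableOn ℝ P.Φ P.X) {u : ℝ → Euc m} {x l : ℝ → Euc n}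
    (hopt : P.IsOptimal u x) (hltf : l P.tf = gradient P.Φ (x P.tf))
    (hli : IntervalIntegrable (fun t ↦ P.costateRhs (x t) (u t) (l t)) volume P.t₀ P.tf)
    (hl : IsCaratheodorySolution (fun t k ↦ P.costateRhs (x t) (u t) k) P.t₀ P.tf l)
    {η : ℝ} (hη : 0 < η) :
    ∃ ε > 0, ∀ w, P.IsControl w → ∫ t in P.t₀..P.tf, ‖w t - u t‖ ≤ ε →
      0 ≤ (∫ t in P.t₀..P.tf,
          (P.hamiltonian (x t) (l t) (w t) - P.hamiltonian (x t) (l t) (u t))) +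
        η * ∫ t in P.t₀..P.tf, ‖w t - u t‖ := by
  obtain ⟨hu, hx, hmin⟩ := hopt
  obtain ⟨C, hC, ε₁, hε₁, h₁⟩ := hx.exists_nearby_trajectory ht hX hf hg hu.2.1
  obtain ⟨N, hN, Λ, hΛ, h₂⟩ := exists_cost_sub_le ht hX hf hg hq hΦ hu hx hltf hli hl
  obtain ⟨ε₂, hε₂, h₂⟩ := h₂ (η / (2 * (C * N + 1))) (by positivity)
  refine ⟨min ε₁ (min (ε₂ / (C + 1)) (η / (2 * (C * Λ + 1)))), by positivity, fun w hw hwu ↦ ?_⟩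
  simp only [le_min_iff] at hwu
  obtain ⟨y, hy, hyx⟩ := h₁ w hw.2.1 hwu.1
  set d := ∫ t in P.t₀..P.tf, ‖w t - u t‖ with hd
  have hd0 : 0 ≤ d := intervalIntegral.integral_nonneg ht fun _ _ ↦ norm_nonneg _
  have hCd : C * d ≤ ε₂ := by
    have := (le_div_iff₀ (by positivity)).1 hwu.2.1
    linarith
  have h := h₂ w y hw hy (C * d) (by positivity) hCd hyx
  have h0 := hmin w y hw hy
  -- the two remainders of the expansion take one half of `η` each
  have e1 : C * (η / (2 * (C * N + 1)) * N) ≤ η / 2 := by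
    rw [div_mul_eq_mul_div, mul_div_assoc', div_le_div_iff₀ (by positivity) two_pos]
    linarith
  have e2 : C * (Λ * d) ≤ η / 2 := by
    have := (le_div_iff₀ (by positivity)).1 hwu.2.2
    linarith
  have e3 := mul_le_mul_of_nonneg_right (add_le_add e1 e2) hd0
  rw [← hd] at h
  linarith

end ControlProblem

/-! ### Needle variations and the minimum condition -/

/-- A function with nonnegative increments to the right of a point has nonnegative derivative
there. -/
theorem HasDerivAt.nonneg_of_eventually_le {φ : ℝ → ℝ} {φ' τ : ℝ} (h : HasDerivAt φ φ' τ)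
    (hle : ∀ᶠ s in 𝓝[>] τ, φ τ ≤ φ s) : 0 ≤ φ' := by
  have h1 := (hasDerivWithinAt_iff_tendsto_slope' self_notMem_Ioi).1
    (h.hasDerivWithinAt (s := Ioi τ))
  refine ge_of_tendsto h1 ?_
  filter_upwards [hle, self_mem_nhdsWithin] with s hs hτ
  rw [slope_def_field]
  exact div_nonneg (sub_nonneg.2 hs) (sub_nonneg.2 (le_of_lt hτ))

theorem intervalIntegral_indicator_Ioc {E : Type*} [NormedAddCommGroup E] [NormedSpace ℝ E]
    {φ : ℝ → E} {a b c d : ℝ} (hac : a ≤ c) (hcd : c ≤ d) (hdb : d ≤ b) :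
    ∫ t in a..b, (Ioc c d).indicator φ t = ∫ t in c..d, φ t := by
  rw [intervalIntegral.integral_of_le (hac.trans (hcd.trans hdb)),
    intervalIntegral.integral_of_le hcd, setIntegral_indicator measurableSet_Ioc,
    inter_eq_right.2 (Ioc_subset_Ioc hac hdb)]

theorem IntervalIntegrable.indicator_Ioc {E : Type*} [NormedAddCommGroup E]
    {φ : ℝ → E} {a b : ℝ} (h : IntervalIntegrable φ volume a b) (c d : ℝ) :
    IntervalIntegrable ((Ioc c d).indicator φ) volume a b := by
  rw [intervalIntegrable_iff] at h ⊢
  exact h.indicator measurableSet_Ioc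

/-- A property that holds almost everywhere on an interval holds on a dense subset of it. -/
theorem mem_closure_of_ae_Icc {p : ℝ → Prop} {a b t : ℝ} (hab : a < b) (ht : t ∈ Icc a b)
    (hp : ∀ᵐ s, s ∈ Icc a b → p s) : t ∈ closure {s ∈ Icc a b | p s} := by
  rw [← closure_Ioo hab.ne] at ht
  rw [mem_closure_iff] at ht ⊢
  intro V hV htV
  have hpos : 0 < volume (V ∩ Ioo a b) :=
    (hV.inter isOpen_Ioo).measure_pos volume (ht V hV htV)
  obtain ⟨s, hs, hs'⟩ := nonempty_of_measure_ne_zero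
    (show volume ((V ∩ Ioo a b) ∩ {s | s ∈ Icc a b → p s}) ≠ 0 by
      rw [measure_inter_conull (mem_ae_iff.1 hp)]; exact hpos.ne')
  exact ⟨s, hs.1, Ioo_subset_Icc_self hs.2, hs' (Ioo_subset_Icc_self hs.2)⟩

/-- An absolutely continuous function has the one-sided or two-sided derivative prescribed by its
a.e. derivative wherever the latter is continuous. -/
theorem AbsolutelyContinuousOnInterval.hasDerivWithinAt {E : Type*} [NormedAddCommGroup E]
    [NormedSpace ℝ E] [CompleteSpace E] {y F : ℝ → E} {t₀ tf a b t : ℝ} (h : t₀ ≤ tf)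
    (hy : AbsolutelyContinuousOnInterval y t₀ tf) (hF : IntervalIntegrable F volume t₀ tf)
    (hd : ∀ᵐ s ∂(volume.restrict (Icc t₀ tf)), HasDerivAt y (F s) s) (ha : t₀ ≤ a) (hb : b ≤ tf)
    (ht : t ∈ Icc a b) (hc : ContinuousWithinAt F (Icc a b) t) :
    HasDerivWithinAt y (F t) (Icc a b) t := by
  rw [ae_restrict_iff' measurableSet_Icc, ← uIcc_of_le h] at hd
  have hsub : Icc a b ⊆ Icc t₀ tf := Icc_subset_Icc ha hb
  have : Fact (t ∈ Icc a b) := ⟨ht⟩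
  have hm : StronglyMeasurableAtFilter F (𝓝[Icc a b] t) :=
    ⟨Icc a b, self_mem_nhdsWithin, by
      rw [intervalIntegrable_iff_integrableOn_Icc_of_le h] at hF
      exact (hF.mono_set hsub).1⟩
  have h1 := (intervalIntegral.integral_hasDerivWithinAt_right (a := t) (s := Icc a b)
    IntervalIntegrable.refl hm hc).const_add (y t)
  have e : ∀ s ∈ Icc a b, y s = y t + ∫ r in t..s, F r := fun s hs ↦ by
    rw [hy.integral_eq_sub hF hd (uIcc_of_le h ▸ hsub ht) (uIcc_of_le h ▸ hsub hs)]
    abel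
  exact h1.congr e (e t ht)

namespace ControlProblem

variable {n m : ℕ} {P : ControlProblem n m}

/-- The needle variation: at almost every time the Hamiltonian of the optimal control is at most
that of a given control value. The exceptional null set depends on the value. -/
theorem IsOptimal.ae_hamiltonian_le (ht : P.t₀ < P.tf) (hX : IsOpen P.X)
    (hf : ContDiffOn ℝ 1 P.f P.X) (hg : ContDiffOn ℝ 1 P.g P.X) (hq : ContDiffOn ℝ 1 P.q P.X)
    (hΦ : DifferentiableOn ℝ P.Φ P.X) {u : ℝ → Euc m} {x l : ℝ → Euc n}
    (hopt : P.IsOptimal u x) (hltf : l P.tf = gradient P.Φ (x P.tf))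
    (hli : IntervalIntegrable (fun t ↦ P.costateRhs (x t) (u t) (l t)) volume P.t₀ P.tf)
    (hl : IsCaratheodorySolution (fun t k ↦ P.costateRhs (x t) (u t) k) P.t₀ P.tf l)
    {v : Euc m} (hv : v ∈ P.U) :
    ∀ᵐ t, t ∈ Icc P.t₀ P.tf → P.hamiltonian (x t) (l t) (u t) ≤ P.hamiltonian (x t) (l t) v := by
  have hI : uIcc P.t₀ P.tf = Icc P.t₀ P.tf := uIcc_of_le ht.le
  obtain ⟨hu, hx, -⟩ := id hopt
  set h : ℝ → ℝ := fun t ↦ P.hamiltonian (x t) (l t) v - P.hamiltonian (x t) (l t) (u t)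
  set d : ℝ → ℝ := fun t ↦ ‖v - u t‖
  have hhi : IntervalIntegrable h volume P.t₀ P.tf :=
    intervalIntegrable_hamiltonian_sub ht.le hg.continuousOn hu.2.1 intervalIntegrable_const hu.2.2
      intervalIntegrable_const (hx.continuousOn ht.le) hx.1 (hI ▸ hl.1.continuousOn)
  have hdi : IntervalIntegrable d volume P.t₀ P.tf := (intervalIntegrable_const.sub hu.2.1).norm
  have hne : ∀ᵐ t : ℝ, t ≠ P.tf := by simp [ae_iff, measure_singleton]
  filter_upwards [hhi.ae_hasDerivAt_integral, hdi.ae_hasDerivAt_integral, hne] with τ h1 h2 h3 hτ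
  rw [← sub_nonneg]
  have hτtf : τ < P.tf := lt_of_le_of_ne hτ.2 h3
  have hτ' : τ ∈ uIcc P.t₀ P.tf := hI ▸ hτ
  replace h1 := h1 hτ' τ hτ'
  replace h2 := h2 hτ' τ hτ'
  suffices ∀ η > 0, 0 ≤ h τ + η * d τ by
    have hlim : Tendsto (fun η ↦ h τ + η * d τ) (𝓝[>] 0) (𝓝 (h τ + 0 * d τ)) :=
      ((continuous_const.add (continuous_id.mul continuous_const)).tendsto 0).mono_left
        nhdsWithin_le_nhds
    rw [zero_mul, add_zero] at hlim
    exact ge_of_tendsto hlim (by filter_upwards [self_mem_nhdsWithin] with η hη using this η hη)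
  intro η hη
  -- the integral of `h + η d` has nonnegative increments to the right of `τ`
  obtain ⟨ε, hε, H⟩ :=
    hopt.exists_le_integral_hamiltonian_sub ht.le hX hf hg hq hΦ hltf hli hl hη
  refine (h1.add (h2.const_mul η)).nonneg_of_eventually_le ?_
  have hsmall : ∀ᶠ s in 𝓝[>] τ, ∫ r in τ..s, d r < ε := by
    have := h2.continuousAt.tendsto
    simp only [intervalIntegral.integral_same] at this
    exact (this.mono_left nhdsWithin_le_nhds).eventually_lt_const hε
  filter_upwards [hsmall, self_mem_nhdsWithin, Ioo_mem_nhdsGT hτtf] with s hs hτs hsI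
  -- the control that takes the value `v` on `(τ, s]` and agrees with `u` elsewhere
  let w : ℝ → Euc m := fun r ↦ u r + (Ioc τ s).indicator (fun r ↦ v - u r) r
  have hw1 : ∀ r ∈ Ioc τ s, w r = v := fun r hr ↦ by simp [w, hr]
  have hw2 : ∀ r ∉ Ioc τ s, w r = u r := fun r hr ↦ by simp [w, hr]
  have hcw : ∀ r, P.c (w r) = P.c (u r) + (Ioc τ s).indicator (fun r ↦ P.c v - P.c (u r)) r :=
    fun r ↦ by
      by_cases hr : r ∈ Ioc τ s
      · simp [hw1 r hr, hr]
      · simp [hw2 r hr, hr]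
  have hwc : P.IsControl w := by
    refine ⟨fun r hr ↦ ?_, ?_, ?_⟩
    · by_cases hr' : r ∈ Ioc τ s
      · rwa [hw1 r hr']
      · rw [hw2 r hr']; exact hu.1 r hr
    · exact hu.2.1.add ((intervalIntegrable_const.sub hu.2.1).indicator_Ioc τ s)
    · simp only [hcw]
      exact hu.2.2.add ((intervalIntegrable_const.sub hu.2.2).indicator_Ioc τ s)
  have e1 : ∫ t in P.t₀..P.tf, ‖w t - u t‖ = ∫ r in τ..s, d r := by
    rw [← intervalIntegral_indicator_Ioc hτ.1 hsI.1.le hsI.2.le]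
    congr 1 with r
    by_cases hr : r ∈ Ioc τ s
    · simp [hw1 r hr, hr, d]
    · simp [hw2 r hr, hr]
  have e2 : ∫ t in P.t₀..P.tf,
      (P.hamiltonian (x t) (l t) (w t) - P.hamiltonian (x t) (l t) (u t)) =
      ∫ r in τ..s, h r := by
    rw [← intervalIntegral_indicator_Ioc hτ.1 hsI.1.le hsI.2.le]
    congr 1 with r
    by_cases hr : r ∈ Ioc τ s
    · simp [hw1 r hr, hr, h]
    · simp [hw2 r hr, hr]
  have := H w hwc (e1 ▸ hs.le)
  rw [e1, e2] at this
  simpa using this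

/-- The minimum condition at almost every time. By continuity of the control cost it suffices to
compare with the control values from a countable dense set. -/
theorem IsOptimal.ae_minimizesHamiltonian (ht : P.t₀ < P.tf) (hX : IsOpen P.X)
    (hf : ContDiffOn ℝ 1 P.f P.X) (hg : ContDiffOn ℝ 1 P.g P.X) (hq : ContDiffOn ℝ 1 P.q P.X)
    (hc : ContinuousOn P.c P.U)
    (hΦ : DifferentiableOn ℝ P.Φ P.X) {u : ℝ → Euc m} {x l : ℝ → Euc n}
    (hopt : P.IsOptimal u x) (hltf : l P.tf = gradient P.Φ (x P.tf))
    (hli : IntervalIntegrable (fun t ↦ P.costateRhs (x t) (u t) (l t)) volume P.t₀ P.tf)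
    (hl : IsCaratheodorySolution (fun t k ↦ P.costateRhs (x t) (u t) k) P.t₀ P.tf l) :
    ∀ᵐ t, t ∈ Icc P.t₀ P.tf → P.MinimizesHamiltonian (x t) (l t) (u t) := by
  obtain ⟨D, hDU, hD, hUD⟩ :=
    (TopologicalSpace.IsSeparable.of_separableSpace P.U).exists_countable_dense_subset
  have h := (ae_ball_iff hD).2 fun v hv ↦
    hopt.ae_hamiltonian_le ht hX hf hg hq hΦ hltf hli hl (hDU hv)
  filter_upwards [h] with t h ht'
  refine ⟨hopt.1.1 t ht', fun v hv ↦ ?_⟩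
  have hH : ContinuousOn (fun v ↦ P.hamiltonian (x t) (l t) v) P.U :=
    (continuousOn_const.add hc).add (Continuous.continuousOn (by unfold dyn; fun_prop))
  exact ContinuousWithinAt.closure_le (hUD hv) continuousWithinAt_const ((hH v hv).mono hDU)
    fun w hw ↦ h w hw ht'

theorem gradient_hamiltonian_costate (x l : Euc n) (u : Euc m) :
    gradient (fun k ↦ P.hamiltonian x k u) l = P.dyn x u := by
  refine HasGradientAt.gradient (hasGradientAt_iff_hasFDerivAt.2 ?_)
  have := ((innerSL ℝ (P.dyn x u)).hasFDerivAt (x := l)).const_add (P.q x + P.c u)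
  refine this.congr_of_eventuallyEq (.of_forall fun k ↦ ?_)
  simp [hamiltonian, real_inner_comm]

theorem neg_gradient_hamiltonian_state {x : Euc n} (hf : DifferentiableAt ℝ P.f x)
    (hg : DifferentiableAt ℝ P.g x) (hq : DifferentiableAt ℝ P.q x) (l : Euc n) (u : Euc m) :
    -gradient (fun z ↦ P.hamiltonian z l u) x = P.costateRhs x u l := by
  have h : HasGradientAt (fun z ↦ P.hamiltonian z l u) (-P.costateRhs x u l) x := by
    rw [hasGradientAt_iff_hasFDerivAt]
    have h1 := (hq.hasFDerivAt.add_const (P.c u)).add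
      ((innerSL ℝ l).hasFDerivAt.comp x (hasFDerivAt_dyn hf hg u))
    refine h1.congr_fderiv ?_
    ext z
    simp [inner_costateRhs, add_comm]
  rw [h.gradient, neg_neg]

theorem continuousWithinAt_dyn {x : ℝ → Euc n} {u : ℝ → Euc m} {s : Set ℝ} {t : ℝ}
    (hX : IsOpen P.X) (hf : ContinuousOn P.f P.X) (hg : ContinuousOn P.g P.X)
    (hx : ContinuousWithinAt x s t) (hu : ContinuousWithinAt u s t) (hxt : x t ∈ P.X) :
    ContinuousWithinAt (fun r ↦ P.dyn (x r) (u r)) s t :=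
  ((hf.continuousAt (hX.mem_nhds hxt)).comp_continuousWithinAt hx).add
    (((hg.continuousAt (hX.mem_nhds hxt)).comp_continuousWithinAt hx).clm_apply hu)

theorem continuousWithinAt_costateRhs {x l : ℝ → Euc n} {u : ℝ → Euc m} {s : Set ℝ} {t : ℝ}
    (hX : IsOpen P.X) (hf : ContDiffOn ℝ 1 P.f P.X) (hg : ContDiffOn ℝ 1 P.g P.X)
    (hq : ContDiffOn ℝ 1 P.q P.X)
    (hx : ContinuousWithinAt x s t) (hl : ContinuousWithinAt l s t)
    (hu : ContinuousWithinAt u s t) (hxt : x t ∈ P.X) :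
    ContinuousWithinAt (fun r ↦ P.costateRhs (x r) (u r) (l r)) s t := by
  have hA : ContinuousWithinAt (fun r ↦ P.dynDeriv (x r) (u r)) s t := by
    refine (((hf.continuousOn_fderiv_of_isOpen_one hX).continuousAt
      (hX.mem_nhds hxt)).comp_continuousWithinAt hx).add ?_
    exact ((ContinuousLinearMap.flipₗᵢ ℝ (Euc n) (Euc m)
      (Euc n)).continuous.continuousAt.comp_continuousWithinAt
        (((hg.continuousOn_fderiv_of_isOpen_one hX).continuousAt
          (hX.mem_nhds hxt)).comp_continuousWithinAt hx)).clm_apply hu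
  have hA' : ContinuousWithinAt
      (fun r ↦ ContinuousLinearMap.adjoint (P.dynDeriv (x r) (u r))) s t :=
    (ContinuousLinearMap.adjoint (𝕜 := ℝ) (E := Euc n)
      (F := Euc n)).continuous.continuousAt.comp_continuousWithinAt hA
  exact (((continuousOn_gradient_q hX hq).continuousAt
    (hX.mem_nhds hxt)).comp_continuousWithinAt hx).neg.sub (hA'.clm_apply hl)

/-- The minimum condition passes from almost every time to each time of (one-sided) continuity. -/
theorem minimizesHamiltonian_of_continuousWithinAt (hX : IsOpen P.X)
    (hf : ContinuousOn P.f P.X) (hg : ContinuousOn P.g P.X) (hq : ContinuousOn P.q P.X)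
    (hc : ContinuousOn P.c P.U) {u : ℝ → Euc m} {x l : ℝ → Euc n} {a b t : ℝ} (hab : a < b)
    (ht : t ∈ Icc a b) (huU : MapsTo u (Icc a b) P.U) (hxt : x t ∈ P.X)
    (hx : ContinuousWithinAt x (Icc a b) t) (hl : ContinuousWithinAt l (Icc a b) t)
    (hu : ContinuousWithinAt u (Icc a b) t)
    (hmin : ∀ᵐ s, s ∈ Icc a b → P.MinimizesHamiltonian (x s) (l s) (u s)) :
    P.MinimizesHamiltonian (x t) (l t) (u t) := by
  refine ⟨huU ht, fun v hv ↦ ?_⟩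
  have hqx := (hq.continuousAt (hX.mem_nhds hxt)).comp_continuousWithinAt hx
  have hcu : ContinuousWithinAt (fun r ↦ P.c (u r)) (Icc a b) t := (hc _ (huU ht)).comp hu huU
  have h1 : ContinuousWithinAt (fun r ↦ P.hamiltonian (x r) (l r) (u r)) (Icc a b) t :=
    (hqx.add hcu).add (hl.inner (continuousWithinAt_dyn hX hf hg hx hu hxt))
  have h2 : ContinuousWithinAt (fun r ↦ P.hamiltonian (x r) (l r) v) (Icc a b) t :=
    (hqx.add continuousWithinAt_const).add
      (hl.inner (continuousWithinAt_dyn hX hf hg hx continuousWithinAt_const hxt))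
  exact ContinuousWithinAt.closure_le (mem_closure_of_ae_Icc hab ht hmin)
    (h1.mono (sep_subset _ _)) (h2.mono (sep_subset _ _)) fun s hs ↦ hs.2.2 v hv

end ControlProblem

theorem proposition1 {n m : ℕ} (P : ControlProblem n m) (ht : P.t₀ < P.tf)
    (hX : IsOpen P.X)
    (hf : ContDiffOn ℝ 1 P.f P.X) (hg : ContDiffOn ℝ 1 P.g P.X)
    (hq : ContDiffOn ℝ 1 P.q P.X) (hc : ContinuousOn P.c P.U)
    (hΦ : DifferentiableOn ℝ P.Φ P.X)
    (u : ℝ → Euc m) (x : ℝ → Euc n) (hopt : P.IsOptimal u x) :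
    ∃ l : ℝ → Euc n,
      -- boundary conditions
      x P.t₀ = P.x₀ ∧ l P.tf = gradient P.Φ (x P.tf) ∧
      -- the Hamiltonian system `x' = ∇_λ H`, `λ' = - ∇_x H`
      IsCaratheodorySolution
        (fun t z => gradient (fun k => P.hamiltonian z k (u t)) (l t)) P.t₀ P.tf x ∧
      IsCaratheodorySolution
        (fun t k => -gradient (fun z => P.hamiltonian z k (u t)) (x t)) P.t₀ P.tf l ∧
      -- the Hamiltonian is minimized by the optimal control
      (∀ᵐ t ∂(volume.restrict (Icc P.t₀ P.tf)), P.MinimizesHamiltonian (x t) (l t) (u t)) ∧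
      -- the equations and the minimization hold at each single time of (one-sided) continuity
      -- of the control: take `a = t` or `b = t` for one-sided continuity and derivatives
      (∀ a b t, P.t₀ ≤ a → a < b → b ≤ P.tf → t ∈ Icc a b →
        ContinuousWithinAt u (Icc a b) t →
          HasDerivWithinAt x (gradient (fun k => P.hamiltonian (x t) k (u t)) (l t))
            (Icc a b) t ∧
          HasDerivWithinAt l (-gradient (fun z => P.hamiltonian z (l t) (u t)) (x t))
            (Icc a b) t ∧
          P.MinimizesHamiltonian (x t) (l t) (u t)) ∧
      -- the explicit form of the two gradients
      (∀ t ∈ Icc P.t₀ P.tf,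
        gradient (fun k => P.hamiltonian (x t) k (u t)) (l t) = P.f (x t) + P.g (x t) (u t) ∧
        -gradient (fun z => P.hamiltonian z (l t) (u t)) (x t) =
          -gradient P.q (x t) -
            ContinuousLinearMap.adjoint (fderiv ℝ (fun z => P.f z + P.g z (u t)) (x t)) (l t)) := by
  obtain ⟨hu, hx, -⟩ := id hopt
  obtain ⟨l, hltf, hli, hl⟩ :=
    P.exists_costate ht.le hX hf hg hq hu.2.1 hx (gradient P.Φ (x P.tf))
  have hgrad : ∀ t ∈ Icc P.t₀ P.tf, ∀ k,
      -gradient (fun z ↦ P.hamiltonian z k (u t)) (x t) = P.costateRhs (x t) (u t) k :=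
    fun t ht k ↦ ControlProblem.neg_gradient_hamiltonian_state
      (hf.differentiableAt_of_isOpen hX (hx.1 t ht)) (hg.differentiableAt_of_isOpen hX (hx.1 t ht))
      (hq.differentiableAt_of_isOpen hX (hx.1 t ht)) k (u t)
  have hmin := hopt.ae_minimizesHamiltonian ht hX hf hg hq hc hΦ hltf hli hl
  have hxc := hx.continuousOn ht.le
  have hlc : ContinuousOn l (Icc P.t₀ P.tf) := uIcc_of_le ht.le ▸ hl.1.continuousOn
  refine ⟨l, hx.2.1, hltf, ?_, ⟨hl.1, ?_⟩, ?_, ?_, ?_⟩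
  · simpa only [ControlProblem.gradient_hamiltonian_costate] using hx.2.2
  · filter_upwards [hl.2, ae_restrict_mem measurableSet_Icc] with t h ht'
    rwa [hgrad t ht']
  · rwa [ae_restrict_iff' measurableSet_Icc]
  · intro a b t ha hab hb htab huc
    have hsub : Icc a b ⊆ Icc P.t₀ P.tf := Icc_subset_Icc ha hb
    have hxt := hx.1 t (hsub htab)
    have hxw := (hxc t (hsub htab)).mono hsub
    have hlw := (hlc t (hsub htab)).mono hsub
    rw [hgrad t (hsub htab), ControlProblem.gradient_hamiltonian_costate]
    refine ⟨?_, ?_, ?_⟩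
    · exact hx.2.2.1.hasDerivWithinAt (F := fun s ↦ P.dyn (x s) (u s)) ht.le
        (ControlProblem.intervalIntegrable_dyn ht.le hf.continuousOn hg.continuousOn hu.2.1 hxc
          hx.1) hx.2.2.2 ha hb htab
        (ControlProblem.continuousWithinAt_dyn hX hf.continuousOn hg.continuousOn hxw huc hxt)
    · exact hl.1.hasDerivWithinAt (F := fun s ↦ P.costateRhs (x s) (u s) (l s)) ht.le hli hl.2 ha
        hb htab (ControlProblem.continuousWithinAt_costateRhs hX hf hg hq hxw hlw huc hxt)
    · refine ControlProblem.minimizesHamiltonian_of_continuousWithinAt hX hf.continuousOn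
        hg.continuousOn hq.continuousOn hc hab htab (fun s hs ↦ hu.1 s (hsub hs)) hxt hxw hlw huc ?_
      filter_upwards [hmin] with s hs hs' using hs (hsub hs')
  · intro t ht'
    refine ⟨ControlProblem.gradient_hamiltonian_costate _ _ _, ?_⟩
    rw [hgrad t ht', ControlProblem.costateRhs]
    congr 3
    exact (ControlProblem.hasFDerivAt_dyn (hf.differentiableAt_of_isOpen hX (hx.1 t ht'))
      (hg.differentiableAt_of_isOpen hX (hx.1 t ht')) (u t)).fderiv.symm
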